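/- Let $d\in\{2,3\}$, let $\Omega\subset\mathbb R^d$ be a bounded connected nonempty open set with boundary $\Gamma=\partial\Omega$, and let $\mathcal T_h$ be a finite partition of $\Omega$ into closed polygons ($d=2$) or polyhedra ($d=3$), not necessarily convex, with finite set $\mathcal E_h$ of edges or flat faces, such that every boundary $\partial T$, $T\in\mathcal T_h$, is the union of the members of $\mathcal E_h$ contained in it, distinct members of $\mathcal E_h$ have disjoint relative interiors, and every $e\in\mathcal E_h$ either lies in $\Gamma$ or has its relative interior in $\Omega$. Let $k\ge 1$ be an integer, and let the Lamé constants satisfy $\mu>0$ and $\lambda\ge 0$. Let $\mathbf f\in[L^2(\Omega)]^d$ and $\widehat{\mathbf u}\in[L^2(\Gamma)]^d$. For $e\in\mathcal E_h$ let $V_{k-1}(e)=[P_{k-1}(e)]^d+P_{RM}(e)$, where $P_{RM}(e)$ is the set of restrictions to $e$ of the rigid motions $\mathbf x\mapsto\mathbf a+\eta\mathbf x$ ($\mathbf a\in\mathbb R^d$, $\eta^T=-\eta$), and let $Q_b$ be the $L^2(e)$-orthogonal projection onto $V_{k-1}(e)$. Let $V_h$ be the space of all $\mathbf v=\{\mathbf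 v_0,\mathbf v_b\}$ with $\mathbf v_0|_T\in[P_k(T)]^d$ for each $T\in\mathcal T_h$ and $\mathbf v_b|_e\in V_{k-1}(e)$, single-valued, for each $e\in\mathcal E_h$, and let $V_h^0=\{\mathbf v\in V_h:\ \mathbf v_b=0\text{ on }\Gamma\}$. With $\mathbf n$ the unit outward normal on $\partial T$, the discrete weak divergence $\nabla_w\cdot\mathbf v|_T\in P_{k-1}(T)$ and the discrete weak gradient $\nabla_w\mathbf v|_T\in[P_{k-1}(T)]^{d\times d}$ are the unique polynomials such that $$(\nabla_w\cdot\mathbf v,\phi)_T=-(\mathbf v_0,\nabla\phi)_T+\langle\mathbf v_b\cdot\mathbf n,\phi\rangle_{\partial T}\quad\forall\phi\in P_{k-1}(T),$$ $$(\nabla_w\mathbf v,\varphi)_T=-(\mathbf v_0,\nabla\cdot\varphi)_T+\langle\mathbf v_b,\varphi\mathbf n\rangle_{\partial T}\quad\forall\varphi\in[P_{k-1}(T)]^{d\times d},$$ where $\nabla\cdot\varphi$ is taken row by row. Put $\varepsilon_w(\mathbf v)=\frac12(\nabla_w\mathbf v+(\nabla_w\mathbf v)^T)$ and, with $h_T$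 the diameter of $T$, $$a_s(\mathbf w,\mathbf v)=\sum_{T}2(\mu\,\varepsilon_w(\mathbf w),\varepsilon_w(\mathbf v))_T+\sum_{T}(\lambda\nabla_w\cdot\mathbf w,\nabla_w\cdot\mathbf v)_T+\sum_{T}h_T^{-1}\langle Q_b\mathbf w_0-\mathbf w_b,Q_b\mathbf v_0-\mathbf v_b\rangle_{\partial T}.$$ Then there is exactly one $\mathbf u_h=\{\mathbf u_0,\mathbf u_b\}\in V_h$ such that $\mathbf u_b=Q_b\widehat{\mathbf u}$ on $\Gamma$ and $$a_s(\mathbf u_h,\mathbf v)=(\mathbf f,\mathbf v_0)\qquad\forall\,\mathbf v=\{\mathbf v_0,\mathbf v_b\}\in V_h^0.$$ -/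

import Mathlib

open MeasureTheory

noncomputable section

namespace WG

/-! ## Polygons, polyhedra and polytopal partitions -/

/-- The Euclidean space `ℝ^d`. -/
abbrev Vec (d : ℕ) : Type := EuclideanSpace ℝ (Fin d)

/-- A (closed, not necessarily convex) polygon in the plane, polyhedron in space, or segment on the
line: a compact set that is the closure of its interior, has connected interior, and whose boundary
lies on finitely many hyperplanes `{x | ⟪a, x⟫ = c}`, `a ≠ 0`. -/
structure IsPolytope {n : ℕ} (K : Set (Vec n)) : Prop where
  isCompact : IsCompact K
  closure_interior : closure (interior K) = K
  isConnected_interior : IsConnected (interior K)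
  frontier_flat : ∃ H : Finset (Vec n × ℝ), (∀ h ∈ H, h.1 ≠ 0) ∧
    frontier K ⊆ ⋃ h ∈ H, {x : Vec n | inner ℝ h.1 x = h.2}

/-- An edge (`d = 2`) or flat face (`d = 3`): an isometric affine copy in `ℝ^d` of a polytope
of `ℝ^(d-1)`. -/
def IsFlatFace {d : ℕ} (e : Set (Vec d)) : Prop :=
  ∃ (D : Set (Vec (d - 1))) (φ : Vec (d - 1) →ᵃⁱ[ℝ] Vec d), IsPolytope D ∧ e = φ '' D

/-- `n` is the unit outward normal of the polytope `K` at the boundary point `x`: near `x`, the set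
`K` is the half-space through `x` on the side opposite to `n`. -/
def IsOutwardNormal {d : ℕ} (K : Set (Vec d)) (x n : Vec d) : Prop :=
  ‖n‖ = 1 ∧ ∃ r > 0, ∀ y ∈ Metric.ball x r, (y ∈ K ↔ inner ℝ n (y - x) ≤ 0)

open Classical in
/-- The (constant) unit outward normal of `K` on its flat face `e`. -/
def faceNormal {d : ℕ} (K e : Set (Vec d)) : Vec d :=
  if h : ∃ n : Vec d, ∀ x ∈ intrinsicInterior ℝ e, IsOutwardNormal K x n then h.choose else 0

/-- A finite element partition of `Ω` into polygons or polyhedra, with its finite set of edges or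
faces. An edge or face lying in the boundary of an element is a face of that element; an interior
face is then shared by the elements on its two sides. Straight angles between two edges, or two
faces, of an element are allowed. -/
structure Mesh {d : ℕ} (Ω : Set (Vec d)) where
  /-- the (closed) elements -/
  elements : Finset (Set (Vec d))
  /-- the (closed) edges or faces of all the elements -/
  faces : Finset (Set (Vec d))
  isPolytope : ∀ T ∈ elements, IsPolytope T
  isFlatFace : ∀ e ∈ faces, IsFlatFace e
  iUnion_elements : ⋃ T ∈ elements, T = closure Ω
  interior_subset : ∀ T ∈ elements, interior T ⊆ Ω
  disjoint_interior : ∀ T ∈ elements, ∀ T' ∈ elements, T ≠ T' →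
    Disjoint (interior T) (interior T')
  disjoint_faces : ∀ e ∈ faces, ∀ e' ∈ faces, e ≠ e' →
    Disjoint (intrinsicInterior ℝ e) (intrinsicInterior ℝ e')
  face_of_element : ∀ e ∈ faces, ∃ T ∈ elements, e ⊆ frontier T
  frontier_eq : ∀ T ∈ elements, frontier T = ⋃ e ∈ {e ∈ (faces : Set (Set (Vec d))) |
    e ⊆ frontier T}, e
  exists_normal : ∀ T ∈ elements, ∀ e ∈ faces, e ⊆ frontier T →
    ∃ n : Vec d, ∀ x ∈ intrinsicInterior ℝ e, IsOutwardNormal T x n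
  /-- every face is either a boundary face or an interior face -/
  boundary_or_interior : ∀ e ∈ faces, e ⊆ frontier Ω ∨ intrinsicInterior ℝ e ⊆ Ω

/-- The surface measure (arc length if `d = 2`, area if `d = 3`) on the set `e`. -/
def surf {d : ℕ} (e : Set (Vec d)) : Measure (Vec d) := (μHE[d - 1]).restrict e

/-! ## Polynomials as elements of `L²` -/

/-- Real polynomials in the `d` coordinates. -/
abbrev Poly (d : ℕ) : Type := MvPolynomial (Fin d) ℝ

/-- `P_r`: polynomials of total degree at most `r`. -/
abbrev P (d r : ℕ) : Submodule ℝ (Poly d) := MvPolynomial.restrictTotalDegree (Fin d) ℝ r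

/-- The polynomial function on `ℝ^d`. -/
def pev {d : ℕ} (p : Poly d) (x : Vec d) : ℝ := MvPolynomial.eval (fun i => x i) p

/-- The polynomial vector field on `ℝ^d`. -/
def vev {d : ℕ} (p : Fin d → Poly d) (x : Vec d) : Vec d := WithLp.toLp 2 fun i => pev (p i) x

theorem continuous_pev {d : ℕ} (p : Poly d) : Continuous (pev p) := by
  unfold pev
  exact (MvPolynomial.continuous_eval p).comp (by fun_prop)

theorem continuous_vev {d : ℕ} (p : Fin d → Poly d) : Continuous (vev p) := by
  unfold vev
  exact (PiLp.continuous_toLp 2 _).comp (continuous_pi fun i => continuous_pev (p i))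

theorem memLp_of_continuous {d : ℕ} {F : Type*} [NormedAddCommGroup F] (ν : Measure (Vec d))
    {A : Set (Vec d)} (hA : IsCompact A) (hν : ν A ≠ ⊤) {g : Vec d → F}
    [SecondCountableTopologyEither (Vec d) F] (hg : Continuous g) :
    MemLp g 2 (ν.restrict A) := by
  have : IsFiniteMeasure (ν.restrict A) := ⟨by simpa using hν.lt_top⟩
  obtain ⟨C, hC⟩ := hA.exists_bound_of_continuousOn hg.continuousOn
  exact MemLp.of_bound hg.aestronglyMeasurable C
    ((ae_restrict_iff' hA.measurableSet).2 (Filter.Eventually.of_forall hC))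

/-- The class in `L²(A)` of a polynomial. -/
def polyLp {d : ℕ} (ν : Measure (Vec d)) {A : Set (Vec d)} (hA : IsCompact A) (hν : ν A ≠ ⊤) :
    Poly d →ₗ[ℝ] Lp ℝ 2 (ν.restrict A) where
  toFun p := (memLp_of_continuous ν hA hν (continuous_pev p)).toLp (pev p)
  map_add' p q := by
    rw [← MemLp.toLp_add]
    congr 1
    ext x
    simp [pev]
  map_smul' c p := by
    rw [RingHom.id_apply, ← MemLp.toLp_const_smul]
    congr 1
    ext x
    simp [pev]

/-- The class in `[L²(A)]^d` of a polynomial vector field. -/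
def vecLp {d : ℕ} (ν : Measure (Vec d)) {A : Set (Vec d)} (hA : IsCompact A) (hν : ν A ≠ ⊤) :
    (Fin d → Poly d) →ₗ[ℝ] Lp (Vec d) 2 (ν.restrict A) where
  toFun p := (memLp_of_continuous ν hA hν (continuous_vev p)).toLp (vev p)
  map_add' p q := by
    rw [← MemLp.toLp_add]
    congr 1
    ext x i
    simp [vev, pev]
  map_smul' c p := by
    rw [RingHom.id_apply, ← MemLp.toLp_const_smul]
    congr 1
    ext x i
    simp [vev, pev]

theorem IsFlatFace.isCompact {d : ℕ} {e : Set (Vec d)} (he : IsFlatFace e) : IsCompact e := by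
  obtain ⟨D, φ, hD, rfl⟩ := he
  exact hD.isCompact.image φ.continuous

theorem IsFlatFace.measure_ne_top {d : ℕ} {e : Set (Vec d)} (he : IsFlatFace e) :
    (μHE[d - 1] : Measure (Vec d)) e ≠ ⊤ := by
  obtain ⟨D, φ, hD, rfl⟩ := he
  rw [φ.isometry.euclideanHausdorffMeasure_image]
  have h : IsFiniteMeasureOnCompacts (μHE[d - 1] : Measure (Vec (d - 1))) := by
    have h1 := MeasureTheory.isAddHaarMeasure_euclideanHausdorffMeasure (E := Vec (d - 1))
    rw [finrank_euclideanSpace_fin] at h1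
    infer_instance
  exact hD.isCompact.measure_lt_top.ne

/-! ## Weak functions, discrete weak divergence and discrete weak gradient -/

/-- A rigid motion `x ↦ a + η x`, `η` skew-symmetric, as a polynomial vector field. -/
def rigidMotion {d : ℕ} (a : Vec d) (η : Matrix (Fin d) (Fin d) ℝ) : Fin d → Poly d :=
  fun i => MvPolynomial.C (a i) + ∑ j, MvPolynomial.C (η i j) * MvPolynomial.X j

/-- The space `RM` of rigid motions. -/
def RM (d : ℕ) : Submodule ℝ (Fin d → Poly d) where
  carrier := {p | ∃ (a : Vec d) (η : Matrix (Fin d) (Fin d) ℝ), η.transpose = -η ∧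
    p = rigidMotion a η}
  zero_mem' := ⟨0, 0, by simp, by ext1 i; simp [rigidMotion]⟩
  add_mem' := by
    rintro _ _ ⟨a, η, h, rfl⟩ ⟨b, ζ, h', rfl⟩
    refine ⟨a + b, η + ζ, by simp [h, h', add_comm], ?_⟩
    ext1 i
    simp only [rigidMotion, Pi.add_apply, PiLp.add_apply, Matrix.add_apply, map_add, add_mul,
      Finset.sum_add_distrib]
    ring
  smul_mem' := by
    rintro c _ ⟨a, η, h, rfl⟩
    refine ⟨c • a, c • η, by simp [h], ?_⟩
    ext1 i
    simp only [rigidMotion, Pi.smul_apply, PiLp.smul_apply, Matrix.smul_apply, smul_add,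
      Finset.smul_sum, MvPolynomial.smul_eq_C_mul, smul_eq_mul, map_mul, mul_assoc]

/-- Polynomial vector fields of degree at most `r`. -/
def PVec (d r : ℕ) : Submodule ℝ (Fin d → Poly d) := Submodule.pi Set.univ fun _ => P d r

theorem rm_le (d : ℕ) : RM d ≤ PVec d 1 := by
  rintro _ ⟨a, η, -, rfl⟩
  rw [PVec, Submodule.mem_pi]
  intro i _
  rw [MvPolynomial.mem_restrictTotalDegree]
  refine (MvPolynomial.totalDegree_add _ _).trans (max_le (by simp) ?_)
  refine MvPolynomial.totalDegree_finsetSum_le fun j _ => ?_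
  refine (MvPolynomial.totalDegree_mul _ _).trans ?_
  simp

theorem finiteDimensional_PVec (d r : ℕ) : FiniteDimensional ℝ (PVec d r) := by
  let f : PVec d r →ₗ[ℝ] (Fin d → P d r) :=
    { toFun := fun p i => ⟨p.1 i, p.2 i trivial⟩
      map_add' := fun _ _ => rfl
      map_smul' := fun _ _ => rfl }
  refine FiniteDimensional.of_injective f fun p q h => ?_
  ext1
  funext i
  exact congrArg Subtype.val (congrFun h i)

namespace Mesh

variable {d : ℕ} {Ω : Set (Vec d)} (M : Mesh Ω)

open Classical in
/-- The faces of the element `T`. -/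
def facesOf (T : M.elements) : Finset M.faces :=
  Finset.univ.filter fun e => (e : Set (Vec d)) ⊆ frontier (T : Set (Vec d))

/-- A polynomial as an element of `L²(T)`. -/
def elemPoly (T : M.elements) : Poly d →ₗ[ℝ] Lp ℝ 2 (volume.restrict (T : Set (Vec d))) :=
  polyLp volume (M.isPolytope T T.2).isCompact (M.isPolytope T T.2).isCompact.measure_lt_top.ne

/-- A polynomial vector field as an element of `[L²(T)]^d`. -/
def elemVec (T : M.elements) :
    (Fin d → Poly d) →ₗ[ℝ] Lp (Vec d) 2 (volume.restrict (T : Set (Vec d))) :=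
  vecLp volume (M.isPolytope T T.2).isCompact (M.isPolytope T T.2).isCompact.measure_lt_top.ne

/-- The restriction of a polynomial vector field to the face `e`, as an element of `[L²(e)]^d`. -/
def faceVec (e : M.faces) : (Fin d → Poly d) →ₗ[ℝ] Lp (Vec d) 2 (surf (e : Set (Vec d))) :=
  vecLp (μHE[d - 1]) (M.isFlatFace e e.2).isCompact (M.isFlatFace e e.2).measure_ne_top

/-- The unit outward normal of `T` on its face `e`. -/
def normal (T : M.elements) (e : M.faces) : Vec d := faceNormal (T : Set (Vec d)) e

/-- The gradient of a polynomial. -/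
def grad (φ : Poly d) : Fin d → Poly d := fun i => MvPolynomial.pderiv i φ

/-- The row-wise divergence of a matrix of polynomials. -/
def divRow (Φ : Matrix (Fin d) (Fin d) (Poly d)) : Fin d → Poly d :=
  fun i => ∑ j, MvPolynomial.pderiv j (Φ i j)

/-- The matrix-vector product `Φ n` for a constant vector `n`. -/
def mulNormal (Φ : Matrix (Fin d) (Fin d) (Poly d)) (n : Vec d) : Fin d → Poly d :=
  fun i => ∑ j, n j • Φ i j

/-- The `L²(T)` inner product of two matrices of polynomials. -/
def matInner (T : M.elements) (A B : Matrix (Fin d) (Fin d) (Poly d)) : ℝ :=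
  ∑ i, ∑ j, inner ℝ (M.elemPoly T (A i j)) (M.elemPoly T (B i j))

/-- Boundary components of weak functions: an element of `[L²(e)]^d` on each edge or face. -/
abbrev FaceFun : Type := ∀ e : M.faces, Lp (Vec d) 2 (surf (e : Set (Vec d)))

/-- `q` is the discrete weak divergence in `P_r(T)` of the weak function `{v₀, v_b}` on `T`:
`(q, φ)_T = -(v₀, ∇φ)_T + ⟨v_b · n, φ⟩_∂T` for all `φ ∈ P_r(T)`. -/
def IsWeakDiv (r : ℕ) (T : M.elements) (v₀ : Lp (Vec d) 2 (volume.restrict (T : Set (Vec d))))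
    (vb : M.FaceFun) (q : Poly d) : Prop :=
  q ∈ P d r ∧ ∀ φ ∈ P d r, inner ℝ (M.elemPoly T q) (M.elemPoly T φ) =
    -inner ℝ v₀ (M.elemVec T (grad φ)) +
      ∑ e ∈ M.facesOf T, inner ℝ (vb e) (M.faceVec e fun i => M.normal T e i • φ)

/-- `G` is the discrete weak gradient in `[P_r(T)]^{d×d}` of the weak function `{v₀, v_b}` on `T`:
`(G, Φ)_T = -(v₀, ∇·Φ)_T + ⟨v_b, Φ n⟩_∂T` for all `Φ ∈ [P_r(T)]^{d×d}`. -/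
def IsWeakGrad (r : ℕ) (T : M.elements) (v₀ : Lp (Vec d) 2 (volume.restrict (T : Set (Vec d))))
    (vb : M.FaceFun) (G : Matrix (Fin d) (Fin d) (Poly d)) : Prop :=
  (∀ i j, G i j ∈ P d r) ∧ ∀ Φ : Matrix (Fin d) (Fin d) (Poly d), (∀ i j, Φ i j ∈ P d r) →
    M.matInner T G Φ = -inner ℝ v₀ (M.elemVec T (divRow Φ)) +
      ∑ e ∈ M.facesOf T, inner ℝ (vb e) (M.faceVec e (mulNormal Φ (M.normal T e)))

end Mesh

/-- A finite-dimensional Riesz representation. -/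
theorem existsUnique_riesz {V : Type*} [AddCommGroup V] [Module ℝ V] (S : Submodule ℝ V)
    [FiniteDimensional ℝ S] (B : V →ₗ[ℝ] V →ₗ[ℝ] ℝ) (hB : ∀ p ∈ S, B p p = 0 → p = 0)
    (l : V →ₗ[ℝ] ℝ) : ∃! q, q ∈ S ∧ ∀ φ ∈ S, B q φ = l φ := by
  let F : S →ₗ[ℝ] Module.Dual ℝ S := (B.domRestrict₁₂ S S)
  have hinj : Function.Injective F := by
    rw [injective_iff_map_eq_zero]
    intro p hp
    have : B p p = 0 := congrArg (fun g : Module.Dual ℝ S => g p) hp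
    exact Subtype.ext (hB p p.2 this)
  have hsurj : Function.Surjective F :=
    (LinearMap.injective_iff_surjective_of_finrank_eq_finrank
      (Subspace.dual_finrank_eq (K := ℝ) (V := S)).symm).1 hinj
  obtain ⟨q, hq⟩ := hsurj (l.comp S.subtype)
  refine ⟨q, ⟨q.2, fun φ hφ => congrArg (fun g : Module.Dual ℝ S => g ⟨φ, hφ⟩) hq⟩, ?_⟩
  rintro q' ⟨hq', h'⟩
  have : F ⟨q', hq'⟩ = F q := by
    rw [hq]
    ext φ
    exact h' φ φ.2
  exact congrArg Subtype.val (hinj this)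

namespace Mesh

variable {d : ℕ} {Ω : Set (Vec d)} (M : Mesh Ω)

theorem elemPoly_injective (T : M.elements) : Function.Injective (M.elemPoly T) := by
  rw [injective_iff_map_eq_zero]
  intro p hp
  have hK := M.isPolytope T T.2
  have h0 : pev p =ᵐ[volume.restrict (T : Set (Vec d))] 0 := by
    have := (memLp_of_continuous volume hK.isCompact hK.isCompact.measure_lt_top.ne
      (continuous_pev p)).coeFn_toLp
    refine this.symm.trans ?_
    have h2 : (M.elemPoly T p : Vec d → ℝ) =ᵐ[volume.restrict (T : Set (Vec d))] 0 := by
      rw [hp]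
      exact Lp.coeFn_zero _ _ _
    exact h2
  have h1 : pev p =ᵐ[volume.restrict (interior (T : Set (Vec d)))] 0 :=
    ae_restrict_of_ae_restrict_of_subset _root_.interior_subset h0
  have h2 : Set.EqOn (pev p) 0 (interior (T : Set (Vec d))) :=
    Measure.eqOn_open_of_ae_eq h1 isOpen_interior (continuous_pev p).continuousOn
      continuousOn_const
  obtain ⟨x, hx⟩ := hK.isConnected_interior.nonempty
  have hcont : Continuous fun y : Fin d → ℝ => (WithLp.toLp 2 y : Vec d) :=
    PiLp.continuous_toLp 2 _
  have hopen := isOpen_interior.preimage hcont (t := interior (T : Set (Vec d)))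
  obtain ⟨r, hr, hball⟩ := Metric.isOpen_iff.1 hopen (fun i => x i) hx
  refine MvPolynomial.funext_set (fun i => Metric.ball (x i) r) (fun i => ?_) fun y hy => ?_
  · rw [Real.ball_eq_Ioo]
    exact Set.Ioo_infinite (by linarith)
  · rw [map_zero]
    have hy' : y ∈ Metric.ball (fun i => x i) r := by
      rw [ball_pi _ hr]
      exact hy
    exact h2 (hball hy')

theorem existsUnique_weakDiv (r : ℕ) (T : M.elements)
    (v₀ : Lp (Vec d) 2 (volume.restrict (T : Set (Vec d)))) (vb : M.FaceFun) :
    ∃! q, M.IsWeakDiv r T v₀ vb q := by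
  let B : Poly d →ₗ[ℝ] Poly d →ₗ[ℝ] ℝ := (innerₗ _).compl₁₂ (M.elemPoly T) (M.elemPoly T)
  let g : Poly d →ₗ[ℝ] (Fin d → Poly d) :=
    LinearMap.pi fun i => (MvPolynomial.pderiv i).toLinearMap
  let m (n : Vec d) : Poly d →ₗ[ℝ] (Fin d → Poly d) := LinearMap.pi fun i => n i • LinearMap.id
  let l : Poly d →ₗ[ℝ] ℝ := -((innerₗ _ v₀).comp ((M.elemVec T).comp g)) +
    ∑ e ∈ M.facesOf T, (innerₗ _ (vb e)).comp ((M.faceVec e).comp (m (M.normal T e)))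
  have hB : ∀ p ∈ P d r, B p p = 0 → p = 0 := by
    intro p _ hp
    apply M.elemPoly_injective T
    rw [map_zero]
    exact inner_self_eq_zero.1 hp
  have h := existsUnique_riesz (P d r) B hB l
  have hl : ∀ φ, l φ = -inner ℝ v₀ (M.elemVec T (grad φ)) +
      ∑ e ∈ M.facesOf T, inner ℝ (vb e) (M.faceVec e fun i => M.normal T e i • φ) := by
    intro φ
    simp only [l, LinearMap.add_apply, LinearMap.sum_apply]
    rfl
  simp only [hl] at h
  exact h

theorem existsUnique_weakGrad (r : ℕ) (T : M.elements)
    (v₀ : Lp (Vec d) 2 (volume.restrict (T : Set (Vec d)))) (vb : M.FaceFun) :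
    ∃! G, M.IsWeakGrad r T v₀ vb G := by
  let π (i j : Fin d) : Matrix (Fin d) (Fin d) (Poly d) →ₗ[ℝ] Poly d :=
    { toFun := fun A => A i j
      map_add' := fun _ _ => rfl
      map_smul' := fun _ _ => rfl }
  let B : Matrix (Fin d) (Fin d) (Poly d) →ₗ[ℝ] Matrix (Fin d) (Fin d) (Poly d) →ₗ[ℝ] ℝ :=
    ∑ i, ∑ j, (innerₗ _).compl₁₂ ((M.elemPoly T).comp (π i j)) ((M.elemPoly T).comp (π i j))
  let g : Matrix (Fin d) (Fin d) (Poly d) →ₗ[ℝ] (Fin d → Poly d) :=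
    LinearMap.pi fun i => ∑ j, (MvPolynomial.pderiv j).toLinearMap.comp (π i j)
  let m (n : Vec d) : Matrix (Fin d) (Fin d) (Poly d) →ₗ[ℝ] (Fin d → Poly d) :=
    LinearMap.pi fun i => ∑ j, n j • π i j
  let l : Matrix (Fin d) (Fin d) (Poly d) →ₗ[ℝ] ℝ :=
    -((innerₗ _ v₀).comp ((M.elemVec T).comp g)) +
    ∑ e ∈ M.facesOf T, (innerₗ _ (vb e)).comp ((M.faceVec e).comp (m (M.normal T e)))
  let S : Submodule ℝ (Matrix (Fin d) (Fin d) (Poly d)) :=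
    { carrier := {A | ∀ i j, A i j ∈ P d r}
      zero_mem' := fun i j => Submodule.zero_mem _
      add_mem' := fun h h' i j => Submodule.add_mem _ (h i j) (h' i j)
      smul_mem' := fun c _ h i j => Submodule.smul_mem _ c (h i j) }
  have : FiniteDimensional ℝ S := by
    let f : S →ₗ[ℝ] (Fin d → Fin d → P d r) :=
      { toFun := fun p i j => ⟨p.1 i j, p.2 i j⟩
        map_add' := fun _ _ => rfl
        map_smul' := fun _ _ => rfl }
    refine FiniteDimensional.of_injective f fun p q h => ?_
    ext1
    funext i j
    exact congrArg Subtype.val (congrFun (congrFun h i) j)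
  have hBm : ∀ A A', B A A' = M.matInner T A A' := by
    intro A A'
    simp only [B, LinearMap.sum_apply]
    rfl
  have hB : ∀ A ∈ S, B A A = 0 → A = 0 := by
    intro A _ hA
    rw [hBm, matInner, Finset.sum_eq_zero_iff_of_nonneg
      fun i _ => Finset.sum_nonneg fun j _ => real_inner_self_nonneg] at hA
    funext i j
    have := (Finset.sum_eq_zero_iff_of_nonneg fun j _ => real_inner_self_nonneg).1
      (hA i (Finset.mem_univ i)) j (Finset.mem_univ j)
    apply M.elemPoly_injective T
    rw [inner_self_eq_zero.1 this]
    exact (map_zero _).symm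
  have h := existsUnique_riesz S B hB l
  have hl : ∀ Φ, l Φ = -inner ℝ v₀ (M.elemVec T (divRow Φ)) +
      ∑ e ∈ M.facesOf T, inner ℝ (vb e) (M.faceVec e (mulNormal Φ (M.normal T e))) := by
    intro Φ
    have hg : g Φ = divRow Φ := by
      funext i
      simp only [g, divRow, LinearMap.pi_apply, LinearMap.sum_apply]
      rfl
    have hm : ∀ n, m n Φ = mulNormal Φ n := by
      intro n
      funext i
      simp only [m, mulNormal, LinearMap.pi_apply, LinearMap.sum_apply]
      rfl
    simp only [l, LinearMap.add_apply, LinearMap.sum_apply, LinearMap.neg_apply,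
      LinearMap.comp_apply, hg, hm]
    rfl
  simp only [hl, hBm] at h
  exact h

/-- The discrete weak divergence `∇_{w,r,T} · {v₀, v_b}`. -/
def weakDiv (r : ℕ) (T : M.elements) (v₀ : Lp (Vec d) 2 (volume.restrict (T : Set (Vec d))))
    (vb : M.FaceFun) : Poly d :=
  (M.existsUnique_weakDiv r T v₀ vb).choose

/-- The discrete weak gradient `∇_{w,r,T} {v₀, v_b}`. -/
def weakGrad (r : ℕ) (T : M.elements) (v₀ : Lp (Vec d) 2 (volume.restrict (T : Set (Vec d))))
    (vb : M.FaceFun) : Matrix (Fin d) (Fin d) (Poly d) :=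
  (M.existsUnique_weakGrad r T v₀ vb).choose

/-! ## Weak finite element spaces -/

/-- The space `V_{k-1}(e) = [P_{k-1}(e)]^d + P_RM(e)` of boundary components on the face `e`. -/
def faceSpace (k : ℕ) (e : M.faces) : Submodule ℝ (Lp (Vec d) 2 (surf (e : Set (Vec d)))) :=
  (PVec d (k - 1)).map (M.faceVec e) ⊔ (RM d).map (M.faceVec e)

instance (k : ℕ) (e : M.faces) : FiniteDimensional ℝ (M.faceSpace k e) := by
  have := finiteDimensional_PVec d (k - 1)
  have := finiteDimensional_PVec d 1
  have : FiniteDimensional ℝ (RM d) := Submodule.finiteDimensional_of_le (rm_le d)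
  unfold faceSpace
  infer_instance

/-- The `L²` projection `Q_b` onto `V_{k-1}(e)`. -/
def Qb (k : ℕ) (e : M.faces) (g : Lp (Vec d) 2 (surf (e : Set (Vec d)))) :
    Lp (Vec d) 2 (surf (e : Set (Vec d))) :=
  (M.faceSpace k e).starProjection g

/-- Pairs `{v₀, v_b}` of a polynomial vector field on each element and a square integrable vector
field on each edge or face. (A polynomial is determined by its values on an element.) -/
abbrev Pairs : Type := (M.elements → Fin d → Poly d) × M.FaceFun

/-- The weak finite element space `V_h`: `v₀ ∈ [P_k(T)]^d` on each element, `v_b ∈ V_{k-1}(e)` on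
each edge or face, with `v_b` single-valued. -/
def V (k : ℕ) : Submodule ℝ M.Pairs where
  carrier := {v | (∀ T, v.1 T ∈ PVec d k) ∧ ∀ e, v.2 e ∈ M.faceSpace k e}
  zero_mem' := ⟨fun _ => Submodule.zero_mem _, fun _ => Submodule.zero_mem _⟩
  add_mem' h h' := ⟨fun T => Submodule.add_mem _ (h.1 T) (h'.1 T),
    fun e => Submodule.add_mem _ (h.2 e) (h'.2 e)⟩
  smul_mem' c _ h := ⟨fun T => Submodule.smul_mem _ c (h.1 T),
    fun e => Submodule.smul_mem _ c (h.2 e)⟩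

/-- The subspace `V_h^0` of the functions of `V_h` with `v_b = 0` on `Γ = ∂Ω`. -/
def V0 (k : ℕ) : Submodule ℝ M.Pairs where
  carrier := {v | v ∈ M.V k ∧ ∀ e : M.faces, (e : Set (Vec d)) ⊆ frontier Ω → v.2 e = 0}
  zero_mem' := ⟨Submodule.zero_mem _, fun _ _ => rfl⟩
  add_mem' := by
    rintro v w ⟨hv, hv'⟩ ⟨hw, hw'⟩
    exact ⟨Submodule.add_mem _ hv hw, fun e he => by simp [hv' e he, hw' e he]⟩
  smul_mem' := by
    rintro c v ⟨hv, hv'⟩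
    exact ⟨Submodule.smul_mem _ c hv, fun e he => by simp [hv' e he]⟩

/-! ## The weak Galerkin scheme -/

/-- The discrete weak divergence of `v ∈ V_h` on `T`, of degree `k - 1`. -/
def divW (k : ℕ) (v : M.Pairs) (T : M.elements) : Poly d :=
  M.weakDiv (k - 1) T (M.elemVec T (v.1 T)) v.2

/-- The discrete weak gradient of `v ∈ V_h` on `T`, of degree `k - 1`. -/
def gradW (k : ℕ) (v : M.Pairs) (T : M.elements) : Matrix (Fin d) (Fin d) (Poly d) :=
  M.weakGrad (k - 1) T (M.elemVec T (v.1 T)) v.2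

/-- The weak strain tensor `ε_w(v) = (∇_w v + (∇_w v)ᵀ) / 2` on `T`. -/
def strainW (k : ℕ) (v : M.Pairs) (T : M.elements) : Matrix (Fin d) (Fin d) (Poly d) :=
  (1 / 2 : ℝ) • (M.gradW k v T + (M.gradW k v T).transpose)

/-- `Q_b v₀ - v_b` on the face `e` of `T`, where `v₀` is the trace from `T`. -/
def jump (k : ℕ) (v : M.Pairs) (T : M.elements) (e : M.faces) :
    Lp (Vec d) 2 (surf (e : Set (Vec d))) :=
  M.Qb k e (M.faceVec e (v.1 T)) - v.2 e

/-- The stabilizer `s(w, v) = ∑_T h_T⁻¹ ⟨Q_b w₀ - w_b, Q_b v₀ - v_b⟩_∂T`. -/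
def stab (k : ℕ) (w v : M.Pairs) : ℝ :=
  ∑ T : M.elements, (Metric.diam (T : Set (Vec d)))⁻¹ *
    ∑ e ∈ M.facesOf T, inner ℝ (M.jump k w T e) (M.jump k v T e)

/-- The bilinear form `a_s(w, v)`, with Lamé constants `mu` and `lam`. -/
def aS (k : ℕ) (mu lam : ℝ) (w v : M.Pairs) : ℝ :=
  ∑ T : M.elements, 2 * (mu * M.matInner T (M.strainW k w T) (M.strainW k v T)) +
  ∑ T : M.elements, lam *
    inner ℝ (M.elemPoly T (M.divW k w T)) (M.elemPoly T (M.divW k v T)) +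
  M.stab k w v

/-- The load `(f, v₀)`, computed element by element. -/
def load (f : Lp (Vec d) 2 (volume.restrict Ω)) (v : M.Pairs) : ℝ :=
  ∑ T : M.elements, ∫ x in (T : Set (Vec d)), inner ℝ (f x) (vev (v.1 T) x)

/-- The restriction of boundary data in `[L²(Γ)]^d` to a face `e ⊆ Γ`. -/
def restrictToFace (g : Lp (Vec d) 2 (surf (frontier Ω))) (e : M.faces)
    (he : (e : Set (Vec d)) ⊆ frontier Ω) : Lp (Vec d) 2 (surf (e : Set (Vec d))) :=
  ((Lp.memLp g).mono_measure (Measure.restrict_mono he le_rfl)).toLp g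

/-- `u = {u₀, u_b}` solves the primal weak Galerkin scheme: `u ∈ V_h`, `u_b = Q_b û` on `Γ`, and
`a_s(u, v) = (f, v₀)` for all `v ∈ V_h^0`. -/
def IsSolution (k : ℕ) (mu lam : ℝ) (f : Lp (Vec d) 2 (volume.restrict Ω))
    (uhat : Lp (Vec d) 2 (surf (frontier Ω))) (u : M.Pairs) : Prop :=
  u ∈ M.V k ∧
  (∀ (e : M.faces) (he : (e : Set (Vec d)) ⊆ frontier Ω),
    u.2 e = M.Qb k e (M.restrictToFace uhat e he)) ∧
  ∀ v ∈ M.V0 k, M.aS k mu lam u v = M.load f v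

end Mesh

end WG

end

noncomputable section

namespace WG

open Filter Topology

/-! ## Polynomial calculus -/

/-! The boundary values are lifted by a fixed element of `V_h`, so the unknown lives in the
finite-dimensional space `V_h^0`. There the problem is a square linear system, and both existence
and uniqueness follow once `a_s(v, v) = 0` forces `v = 0` (`eq_zero_of_mem_V0`, fed to
`existsUnique_riesz`).

Suppose `a_s(v, v) = 0`. All three sums are nonnegative, so the weak strain vanishes and `v_b = Q_b
v₀` on every face. For a test matrix `Φ` of degree at most `k - 1`, the field `Φ n` is a polynomial
of that degree on a flat face, so `Q_b` can be dropped when pairing with it. Integration by parts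
then identifies the weak gradient with the true gradient of `v₀` (`gradW_eq_grad`). Zero strain
makes `v₀` a rigid motion on each element. Traces of rigid motions belong to `V_{k-1}(e)`, so now
`v_b = v₀` on each face. A rigid motion vanishing on a flat face is zero; hence `v₀` vanishes on an
element touching the boundary, and then on every element, passing from neighbour to neighbour
through common faces.

The geometric work is caused by nonconvex elements. Both the divergence theorem on an element and
the connectivity of the mesh rest on one general position fact (`ae_line_meets_interior`): almost
every line of a given direction meets the faces only at relative interior points, and transversally.
Along such a line the indicator of an element is a signed count of face crossings
(`indicator_eq_neg_sum_sign`). Integrating this count against a directional derivative gives the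
divergence theorem. -/

theorem pev_add {d : ℕ} (p q : Poly d) (x : Vec d) : pev (p + q) x = pev p x + pev q x := by
  simp [pev]

theorem pev_mul {d : ℕ} (p q : Poly d) (x : Vec d) : pev (p * q) x = pev p x * pev q x := by
  simp [pev]

theorem pev_sum {d : ℕ} {ι : Type*} (s : Finset ι) (p : ι → Poly d) (x : Vec d) :
    pev (∑ i ∈ s, p i) x = ∑ i ∈ s, pev (p i) x := by
  simp [pev]

theorem hasFDerivAt_pev {d : ℕ} (p : Poly d) (x : Vec d) :
    HasFDerivAt (pev p) (∑ j, pev (MvPolynomial.pderiv j p) x •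
      (EuclideanSpace.proj j : Vec d →L[ℝ] ℝ)) x := by
  induction p using MvPolynomial.induction_on with
  | C a =>
    have : pev (MvPolynomial.C a : Poly d) = fun _ => a := by ext; simp [pev]
    rw [this]
    exact (hasFDerivAt_const a x).congr_fderiv (by simp [pev])
  | add p q hp hq =>
    have : pev (p + q) = pev p + pev q := by ext; simp [pev]
    rw [this]
    refine (hp.add hq).congr_fderiv ?_
    simp [pev_add, add_smul, Finset.sum_add_distrib]
  | mul_X p i hp =>
    have : pev (p * MvPolynomial.X i) = fun x => pev p x * x i := by ext; simp [pev]
    rw [this]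
    have hi : HasFDerivAt (fun x : Vec d => x i) (EuclideanSpace.proj i : Vec d →L[ℝ] ℝ) x :=
      (EuclideanSpace.proj i : Vec d →L[ℝ] ℝ).hasFDerivAt
    refine (hp.mul hi).congr_fderiv ?_
    ext v
    simp only [MvPolynomial.pderiv_mul, MvPolynomial.pderiv_X, pev_add, pev_mul, add_smul,
      Finset.sum_add_distrib, add_apply, sum_apply,
      smul_apply, smul_eq_mul, Finset.mul_sum]
    rw [add_comm]
    congr 1
    · refine Finset.sum_congr rfl fun j _ => ?_
      simp only [pev, MvPolynomial.eval_X]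
      ring
    · rw [Finset.sum_eq_single i]
      · simp [pev]
      · intro j _ hj
        simp [pev, hj.symm]
      · simp

theorem fderiv_pev_single {d : ℕ} (p : Poly d) (x : Vec d) (j : Fin d) :
    fderiv ℝ (pev p) x (EuclideanSpace.single j 1) = pev (MvPolynomial.pderiv j p) x := by
  rw [(hasFDerivAt_pev p x).fderiv]
  simp

theorem contDiff_pev {d : ℕ} {n : WithTop ℕ∞} (p : Poly d) : ContDiff ℝ n (pev p) := by
  induction p using MvPolynomial.induction_on with
  | C a =>
    have : pev (MvPolynomial.C a : Poly d) = fun _ => a := by ext; simp [pev]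
    rw [this]
    exact contDiff_const
  | add p q hp hq =>
    have : pev (p + q) = fun x => pev p x + pev q x := by ext; simp [pev]
    rw [this]
    exact hp.add hq
  | mul_X p i hp =>
    have : pev (p * MvPolynomial.X i) = fun x => pev p x * x i := by ext; simp [pev]
    rw [this]
    exact hp.mul (EuclideanSpace.proj i : Vec d →L[ℝ] ℝ).contDiff

/-- A monomial `m ≠ 0` has a positive exponent in some variable, and differentiating in that
variable multiplies its coefficient by a nonzero integer. -/
theorem eq_C_of_pderiv_eq_zero {σ : Type*} {p : MvPolynomial σ ℝ}
    (h : ∀ i, MvPolynomial.pderiv i p = 0) : p = MvPolynomial.C (p.coeff 0) := by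
  classical
  ext m
  rw [MvPolynomial.coeff_C]
  split_ifs with hm
  · rw [← hm]
  · obtain ⟨i, hi⟩ : ∃ i, m i ≠ 0 := by
      by_contra! hc
      exact hm (by ext i; simp [hc i])
    have h1 := MvPolynomial.coeff_pderiv (i := i) p (m - Finsupp.single i 1)
    have h2 : m - Finsupp.single i 1 + Finsupp.single i 1 = m :=
      tsub_add_cancel_of_le (by simpa [Nat.one_le_iff_ne_zero] using hi)
    rw [h i, MvPolynomial.coeff_zero, h2] at h1
    have h3 : (((m - Finsupp.single i 1 : σ →₀ ℕ) i : ℕ) : ℝ) + 1 ≠ 0 := by positivity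
    exact (mul_eq_zero.1 h1.symm).resolve_right h3

theorem pderiv_pderiv_comm {σ : Type*} (i j : σ) (p : MvPolynomial σ ℝ) :
    MvPolynomial.pderiv i (MvPolynomial.pderiv j p) =
      MvPolynomial.pderiv j (MvPolynomial.pderiv i p) := by
  classical
  ext m
  simp only [MvPolynomial.coeff_pderiv]
  by_cases hij : i = j
  · rw [hij]
  · rw [add_right_comm]
    simp [hij, Ne.symm hij]
    ring

/-- For `r = 0` the truncated difference `r - 1 = 0` is harmless: a constant has zero derivatives.
-/
theorem pderiv_mem_P {d r : ℕ} {p : Poly d} (hp : p ∈ P d r) (i : Fin d) :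
    MvPolynomial.pderiv i p ∈ P d (r - 1) := by
  rw [MvPolynomial.mem_restrictTotalDegree] at hp ⊢
  refine Finset.sup_le fun m hm => ?_
  rw [MvPolynomial.mem_support_iff, MvPolynomial.coeff_pderiv] at hm
  have h1 : m + Finsupp.single i 1 ∈ p.support :=
    MvPolynomial.mem_support_iff.2 (left_ne_zero_of_mul hm)
  have h2 := (MvPolynomial.le_totalDegree h1).trans hp
  change (m + Finsupp.single i 1).degree ≤ r at h2
  change m.degree ≤ r - 1
  rw [map_add, Finsupp.degree_single] at h2
  omega

/-- A polynomial vector field with vanishing strain is a rigid motion. -/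
theorem mem_RM_of_strain_eq_zero {d : ℕ} {p : Fin d → Poly d}
    (h : ∀ i j, MvPolynomial.pderiv j (p i) + MvPolynomial.pderiv i (p j) = 0) : p ∈ RM d := by
  classical
  have h2 : ∀ i j l, MvPolynomial.pderiv l (MvPolynomial.pderiv j (p i)) = 0 := by
    have hs : ∀ i j l, MvPolynomial.pderiv l (MvPolynomial.pderiv j (p i)) =
        -MvPolynomial.pderiv l (MvPolynomial.pderiv i (p j)) := fun i j l => by
      rw [eq_neg_iff_add_eq_zero, ← map_add, h, map_zero]
    intro i j l
    -- `∂_l ∂_j p_i` is symmetric in `l, j` and antisymmetric in `i, j`. Three sign changes,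
    -- alternated with exchanges of derivatives, return it to its own negative.
    have h3 : MvPolynomial.pderiv l (MvPolynomial.pderiv j (p i)) =
        -MvPolynomial.pderiv l (MvPolynomial.pderiv j (p i)) := by
      conv_lhs => rw [hs i j l, pderiv_pderiv_comm l i, hs j l i, pderiv_pderiv_comm i j,
        hs l i j, pderiv_pderiv_comm j l]
      simp
    exact self_eq_neg.1 h3
  let η : Matrix (Fin d) (Fin d) ℝ := fun i j => (MvPolynomial.pderiv j (p i)).coeff 0
  have hη : ∀ i j, MvPolynomial.pderiv j (p i) = MvPolynomial.C (η i j) := fun i j =>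
    eq_C_of_pderiv_eq_zero (h2 i j)
  let a : Vec d := WithLp.toLp 2 fun i => (p i).coeff 0
  refine ⟨a, η, ?_, ?_⟩
  · ext i j
    have := h j i
    rw [hη, hη, ← map_add, MvPolynomial.C_eq_zero] at this
    simp only [Matrix.transpose_apply, Matrix.neg_apply]
    linarith
  · funext i
    have h4 : ∀ l, MvPolynomial.pderiv l (p i - ∑ j, MvPolynomial.C (η i j) * MvPolynomial.X j)
        = 0 := fun l => by
      simp [map_sub, map_sum, hη, MvPolynomial.pderiv_X, Pi.single_apply]
    have h5 := eq_C_of_pderiv_eq_zero h4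
    have h6 : (p i - ∑ j, MvPolynomial.C (η i j) * MvPolynomial.X j).coeff 0 = (p i).coeff 0 := by
      simp [MvPolynomial.coeff_sum, MvPolynomial.coeff_C_mul]
    rw [h6, sub_eq_iff_eq_add] at h5
    exact h5

/-! ## `L²` inner products of polynomials -/

theorem inner_polyLp {d : ℕ} (ν : Measure (Vec d)) {A : Set (Vec d)} (hA : IsCompact A)
    (hν : ν A ≠ ⊤) (p q : Poly d) :
    inner ℝ (polyLp ν hA hν p) (polyLp ν hA hν q) = ∫ x in A, pev (p * q) x ∂ν := by
  rw [L2.inner_def]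
  refine integral_congr_ae ?_
  filter_upwards [(memLp_of_continuous ν hA hν (continuous_pev p)).coeFn_toLp,
    (memLp_of_continuous ν hA hν (continuous_pev q)).coeFn_toLp] with x hx hx'
  have hx : polyLp ν hA hν p x = pev p x := hx
  have hx' : polyLp ν hA hν q x = pev q x := hx'
  rw [hx, hx', pev_mul, real_inner_comm]
  simp

theorem inner_vecLp {d : ℕ} (ν : Measure (Vec d)) {A : Set (Vec d)} (hA : IsCompact A)
    (hν : ν A ≠ ⊤) (p q : Fin d → Poly d) :
    inner ℝ (vecLp ν hA hν p) (vecLp ν hA hν q) = ∫ x in A, pev (∑ i, p i * q i) x ∂ν := by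
  rw [L2.inner_def]
  refine integral_congr_ae ?_
  filter_upwards [(memLp_of_continuous ν hA hν (continuous_vev p)).coeFn_toLp,
    (memLp_of_continuous ν hA hν (continuous_vev q)).coeFn_toLp] with x hx hx'
  have hx : vecLp ν hA hν p x = vev p x := hx
  have hx' : vecLp ν hA hν q x = vev q x := hx'
  rw [hx, hx', pev_sum, PiLp.inner_apply]
  simp [pev_mul, vev, mul_comm]

/-! ## Geometry of flat faces -/

/-- A hyperplane is a null set. -/
theorem ae_inner_ne {d : ℕ} {b : Vec d} (hb : b ≠ 0) (c : ℝ) :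
    ∀ᵐ x : Vec d, inner ℝ b x ≠ c := by
  have hne : (innerₗ (Vec d) b) b ≠ 0 := by
    simpa using hb
  have hp : innerₗ (Vec d) b ((c / innerₗ (Vec d) b b) • b) = c := by
    rw [map_smul, smul_eq_mul, div_mul_cancel₀ _ hne]
  -- The hyperplane is a proper affine subspace because its direction, the kernel of `⟪b, ·⟫`, does
  -- not contain `b`.
  have h := Measure.addHaar_affineSubspace (volume : Measure (Vec d))
    (AffineSubspace.mk' ((c / innerₗ (Vec d) b b) • b) (LinearMap.ker (innerₗ (Vec d) b))) (by
      intro htop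
      have h1 := congrArg AffineSubspace.direction htop
      rw [AffineSubspace.direction_mk', AffineSubspace.direction_top] at h1
      have h2 : b ∈ LinearMap.ker (innerₗ (Vec d) b) := h1 ▸ Submodule.mem_top
      exact hne (LinearMap.mem_ker.1 h2))
  rw [ae_iff]
  refine measure_mono_null (fun x hx => ?_) h
  simp only [Set.mem_ofPred_eq, not_not] at hx
  rw [SetLike.mem_coe, AffineSubspace.mem_mk', LinearMap.mem_ker, vsub_eq_sub, map_sub, hp,
    sub_eq_zero]
  exact hx

/-- A flat face is parametrized by a polytope of `ℝ^(d-1)`. -/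
theorem IsFlatFace.exists_chart {m : ℕ} {e : Set (Vec (m + 1))} (he : IsFlatFace e) :
    ∃ (D : Set (Vec m)) (φ : Vec m →ᵃⁱ[ℝ] Vec (m + 1)), IsPolytope D ∧ e = φ '' D ∧
      φ '' interior D ⊆ intrinsicInterior ℝ e := by
  obtain ⟨D, φ, hD, rfl⟩ : ∃ (D : Set (Vec m)) (φ : Vec m →ᵃⁱ[ℝ] Vec (m + 1)),
    IsPolytope D ∧ e = φ '' D := he
  refine ⟨D, φ, hD, rfl, ?_⟩
  rw [φ.intrinsicInterior_image]
  exact Set.image_mono interior_subset_intrinsicInterior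

theorem map_eq_add_linear {m d : ℕ} (φ : Vec m →ᵃⁱ[ℝ] Vec d) (y : Vec m) :
    φ y = φ.linearIsometry y + φ 0 := by
  have := φ.map_vadd 0 y
  simpa using this

/-- A normal of `K` along a flat face of `K` is orthogonal to the face. -/
theorem inner_normal_linear_eq_zero {m : ℕ} {K : Set (Vec (m + 1))} {D : Set (Vec m)}
    {φ : Vec m →ᵃⁱ[ℝ] Vec (m + 1)} (hD : (interior D).Nonempty) (hK : φ '' D ⊆ K)
    {n : Vec (m + 1)} (hn : ∀ x ∈ φ '' interior D, IsOutwardNormal K x n) (u : Vec m) :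
    inner ℝ n (φ.linearIsometry u) = 0 := by
  obtain ⟨y, hy⟩ := hD
  obtain ⟨-, r, hr, hball⟩ := hn (φ y) ⟨y, hy, rfl⟩
  -- Small displacements along the face stay in `K`, which is locally the half-space opposite to
  -- `n`. Applying this to `u` and `-u` leaves only orthogonality.
  have key : ∀ u : Vec m, ∀ᶠ t : ℝ in 𝓝 0, inner ℝ n (φ.linearIsometry (t • u)) ≤ 0 := by
    intro u
    have hc : ContinuousAt (fun t : ℝ => y + t • u) 0 := by fun_prop
    have hc' : ContinuousAt (fun t : ℝ => φ (y + t • u)) 0 :=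
      (φ.continuous.comp (by fun_prop : Continuous fun t : ℝ => y + t • u)).continuousAt
    have hi : interior D ∈ 𝓝 (y + (0 : ℝ) • u) := by
      rw [zero_smul, add_zero]
      exact isOpen_interior.mem_nhds hy
    have hi' : Metric.ball (φ y) r ∈ 𝓝 (φ (y + (0 : ℝ) • u)) := by
      rw [zero_smul, add_zero]
      exact Metric.ball_mem_nhds (φ y) hr
    filter_upwards [hc.eventually_mem hi, hc'.eventually_mem hi'] with t h1 h2
    have h3 := (hball _ h2).1 (hK ⟨_, interior_subset h1, rfl⟩)
    rwa [map_eq_add_linear φ (y + t • u), map_eq_add_linear φ y, map_add,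
      add_sub_add_right_eq_sub, add_sub_cancel_left] at h3
  have hev := ((key u).and (key (-u))).filter_mono
    (nhdsWithin_le_nhds (s := Set.Ioi (0 : ℝ)))
  obtain ⟨t, ⟨h1, h2⟩, ht⟩ := (hev.and self_mem_nhdsWithin).exists
  simp only [map_smul, map_neg, inner_smul_right, inner_neg_right, smul_neg] at h1 h2
  have ht : 0 < t := ht
  nlinarith

theorem inner_normal_chart {m : ℕ} {φ : Vec m →ᵃⁱ[ℝ] Vec (m + 1)} {n : Vec (m + 1)}
    (hn : ∀ u, inner ℝ n (φ.linearIsometry u) = 0) (y : Vec m) :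
    inner ℝ n (φ y) = inner ℝ n (φ 0) := by
  rw [map_eq_add_linear φ y, inner_add_right, hn, zero_add]

/-- Almost every line of direction `v` meets a flat face only in its relative interior, and
transversally. -/
theorem ae_line_meets_interior {m : ℕ} {D : Set (Vec m)} (hD : IsPolytope D)
    {φ : Vec m →ᵃⁱ[ℝ] Vec (m + 1)} {n : Vec (m + 1)} (hn0 : n ≠ 0)
    (hn : ∀ u, inner ℝ n (φ.linearIsometry u) = 0) (v : Vec (m + 1)) :
    ∀ᵐ x : Vec (m + 1), ∀ τ : ℝ, x + τ • v ∈ φ '' D →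
      x + τ • v ∈ φ '' interior D ∧ inner ℝ n v ≠ 0 := by
  by_cases hv : inner ℝ n v = 0
  -- For `v` parallel to the face, only lines contained in its hyperplane can meet it, and these
  -- fill a null set.
  · filter_upwards [ae_inner_ne hn0 (inner ℝ n (φ 0))] with x hx τ hτ
    obtain ⟨y, -, hy⟩ := hτ
    have h := inner_normal_chart hn y
    rw [hy, inner_add_right, inner_smul_right, hv, mul_zero, add_zero] at h
    exact absurd h hx
  · obtain ⟨H, hH0, hH⟩ := hD.frontier_flat
    -- The relative boundary lies on hyperplanes `⟪a, y⟫ = c` of the chart. The covector `b a`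
    -- restricts to `a` on the face and kills `v`, so the lines through such a piece fill part of a
    -- hyperplane with normal `b a`, a null set.
    let b (a : Vec m) : Vec (m + 1) :=
      φ.linearIsometry a - (inner ℝ (φ.linearIsometry a) v / inner ℝ n v) • n
    have hb : ∀ a y, inner ℝ (b a) (φ.linearIsometry y) = inner ℝ a y := fun a y => by
      simp only [b]
      rw [inner_sub_left, inner_smul_left, hn, mul_zero, sub_zero, LinearIsometry.inner_map_map]
    have hbv : ∀ a, inner ℝ (b a) v = 0 := fun a => by
      simp only [b]
      rw [inner_sub_left, real_inner_smul_left, div_mul_cancel₀ _ hv, sub_self]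
    have hae : ∀ᵐ x : Vec (m + 1), ∀ h ∈ H, inner ℝ (b h.1) x ≠ h.2 + inner ℝ (b h.1) (φ 0) := by
      rw [Finset.eventually_all]
      intro h hh
      refine ae_inner_ne (fun h0 => hH0 h hh ?_) _
      have := hb h.1 h.1
      rw [h0, inner_zero_left] at this
      exact inner_self_eq_zero.1 this.symm
    filter_upwards [hae] with x hx τ hτ
    refine ⟨?_, hv⟩
    obtain ⟨y, hyD, hy⟩ := hτ
    by_contra hcon
    have hyf : y ∈ frontier D := ⟨subset_closure hyD, fun hi => hcon ⟨y, hi, hy⟩⟩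
    obtain ⟨h, hh, hyh⟩ : ∃ h ∈ H, inner ℝ h.1 y = h.2 := by simpa using hH hyf
    refine hx h hh ?_
    have h1 : inner ℝ (b h.1) (x + τ • v) = inner ℝ (b h.1) x := by
      rw [inner_add_right, inner_smul_right, hbv, mul_zero, add_zero]
    rw [← h1, ← hy, map_eq_add_linear φ y, inner_add_right, hb, hyh]

/-! ## Line sections of a polytope -/

section Line

variable {A : Set ℝ} {τ₀ : ℝ}

/-- This lemma and the next two compute the right-hand germ of a line section near a parameter `τ₀`
that is, respectively, not a crossing, an exit point or an entry point. -/
theorem eventually_right_iff {P : Prop} (h : ∀ᶠ s in 𝓝 τ₀, (s ∈ A ↔ P)) :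
    ∀ᶠ τ in 𝓝 τ₀, ((∀ᶠ s in 𝓝[>] τ, s ∈ A) ↔ P) := by
  filter_upwards [eventually_eventually_nhds.2 h] with τ hτ
  rw [Filter.eventually_congr (hτ.filter_mono nhdsWithin_le_nhds)]
  simp

theorem eventually_right_iff_lt (h : ∀ᶠ s in 𝓝 τ₀, (s ∈ A ↔ s ≤ τ₀)) :
    ∀ᶠ τ in 𝓝 τ₀, ((∀ᶠ s in 𝓝[>] τ, s ∈ A) ↔ τ < τ₀) := by
  filter_upwards [eventually_eventually_nhds.2 h] with τ hτ
  rw [Filter.eventually_congr (hτ.filter_mono nhdsWithin_le_nhds)]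
  constructor
  · intro h1
    obtain ⟨s, hs, hs'⟩ := (h1.and self_mem_nhdsWithin).exists
    exact lt_of_lt_of_le hs' hs
  · intro h1
    exact ((eventually_lt_nhds h1).filter_mono nhdsWithin_le_nhds).mono fun s hs => hs.le

theorem eventually_right_iff_le (h : ∀ᶠ s in 𝓝 τ₀, (s ∈ A ↔ τ₀ ≤ s)) :
    ∀ᶠ τ in 𝓝 τ₀, ((∀ᶠ s in 𝓝[>] τ, s ∈ A) ↔ τ₀ ≤ τ) := by
  filter_upwards [eventually_eventually_nhds.2 h] with τ hτ
  rw [Filter.eventually_congr (hτ.filter_mono nhdsWithin_le_nhds)]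
  constructor
  · intro h1
    by_contra! h2
    obtain ⟨s, hs, hs'⟩ := (h1.and
      ((eventually_lt_nhds h2).filter_mono nhdsWithin_le_nhds)).exists
    exact absurd hs (not_le.2 hs')
  · intro h1
    filter_upwards [self_mem_nhdsWithin] with s hs
    exact h1.trans (le_of_lt hs)

open Classical in
/-- The crossing formula: along a line that meets the boundary of `K` only in relatively interior
points of finitely many flat faces, and transversally, the indicator function of `K` is
a signed count of the crossings. -/
theorem indicator_eq_neg_sum_sign {d : ℕ} {K : Set (Vec d)} (hK : IsCompact K) {ι : Type*}
    (F : Finset ι) (e : ι → Set (Vec d)) (n : ι → Vec d) (hfr : frontier K = ⋃ i ∈ F, e i)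
    (hflat : ∀ i ∈ F, ∀ y ∈ e i, ∀ z ∈ e i, inner ℝ (n i) (y - z) = 0)
    {x v : Vec d} (hv : v ≠ 0) (hx : x ∉ frontier K)
    (htr : ∀ i ∈ F, ∀ τ : ℝ, x + τ • v ∈ e i → IsOutwardNormal K (x + τ • v) (n i) ∧
      inner ℝ (n i) v ≠ 0 ∧ ∀ j ∈ F, x + τ • v ∈ e j → j = i) :
    K.indicator (fun _ => (1 : ℝ)) x = -∑ i ∈ F, Real.sign (inner ℝ (n i) v) *
      {x | ∃ c ≤ (0 : ℝ), x + c • v ∈ e i}.indicator (fun _ => (1 : ℝ)) x := by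
  have hcont : Continuous fun τ : ℝ => x + τ • v := by fun_prop
  have huniq : ∀ i ∈ F, ∀ τ τ' : ℝ, x + τ • v ∈ e i → x + τ' • v ∈ e i → τ = τ' := by
    intro i hi τ τ' h h'
    have h1 := hflat i hi _ h _ h'
    rw [add_sub_add_left_eq_sub, ← sub_smul, inner_smul_right] at h1
    exact sub_eq_zero.1 ((mul_eq_zero.1 h1).resolve_right (htr i hi τ h).2.1)
  let A : Set ℝ := {s | x + s • v ∈ K}
  -- `N i` records whether face `i` was crossed at or before `τ`, and `R` the membership in `K` just
  -- after `τ`. Both are right-continuous at a crossing, so their jumps cancel exactly in `G`, also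
  -- at the crossing parameter itself.
  let N (i : ι) (τ : ℝ) : ℝ := if ∃ c ≤ τ, x + c • v ∈ e i then 1 else 0
  let R (τ : ℝ) : ℝ := if ∀ᶠ s in 𝓝[>] τ, s ∈ A then 1 else 0
  let G (τ : ℝ) : ℝ := R τ + ∑ i ∈ F, Real.sign (inner ℝ (n i) v) * N i τ
  have hN : ∀ i ∈ F, ∀ τ₀ : ℝ, x + τ₀ • v ∉ e i → ∀ᶠ τ in 𝓝 τ₀, N i τ = N i τ₀ := by
    intro i hi τ₀ hτ₀
    by_cases hc : ∃ c : ℝ, x + c • v ∈ e i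
    · obtain ⟨c, hc⟩ := hc
      have hiff : ∀ τ, (∃ c ≤ τ, x + c • v ∈ e i) ↔ c ≤ τ := fun τ =>
        ⟨fun ⟨c', h1, h2⟩ => huniq i hi _ _ h2 hc ▸ h1, fun h => ⟨c, h, hc⟩⟩
      simp only [N, hiff]
      rcases lt_trichotomy c τ₀ with h | h | h
      · filter_upwards [eventually_gt_nhds h] with τ hτ
        rw [if_pos hτ.le, if_pos h.le]
      · exact absurd (h ▸ hc) hτ₀
      · filter_upwards [eventually_lt_nhds h] with τ hτ
        rw [if_neg (not_le.2 hτ), if_neg (not_le.2 h)]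
    · have h0 : ∀ τ, N i τ = 0 := fun τ => if_neg fun ⟨c, _, h⟩ => hc ⟨c, h⟩
      simp [h0]
  have hR : ∀ τ₀ : ℝ, x + τ₀ • v ∉ frontier K →
      ∀ᶠ τ in 𝓝 τ₀, R τ = if x + τ₀ • v ∈ K then 1 else 0 := by
    intro τ₀ hτ₀
    have hA : ∀ᶠ s in 𝓝 τ₀, (s ∈ A ↔ x + τ₀ • v ∈ K) := by
      by_cases hmem : x + τ₀ • v ∈ K
      · have hi : x + τ₀ • v ∈ interior K := by
          by_contra h
          exact hτ₀ ⟨subset_closure hmem, h⟩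
        filter_upwards [hcont.continuousAt.eventually_mem (isOpen_interior.mem_nhds hi)] with s hs
        exact iff_of_true (show x + s • v ∈ K from interior_subset hs) hmem
      · filter_upwards [hcont.continuousAt.eventually_mem
          (hK.isClosed.isOpen_compl.mem_nhds hmem)] with s hs
        exact iff_of_false hs hmem
    filter_upwards [eventually_right_iff hA] with τ hτ
    simp only [R, hτ]
  -- Away from the frontier every term is locally constant. At a crossing only one `N i` jumps,
  -- because the point belongs to a single face.
  have hloc : ∀ τ₀ : ℝ, ∀ᶠ τ in 𝓝 τ₀, G τ = G τ₀ := by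
    intro τ₀
    by_cases hf : x + τ₀ • v ∈ frontier K
    · rw [hfr] at hf
      obtain ⟨i, hi, hie⟩ : ∃ i ∈ F, x + τ₀ • v ∈ e i := by simpa using hf
      obtain ⟨⟨-, r, hr, hball⟩, hne, hother⟩ := htr i hi τ₀ hie
      have hrest : ∀ᶠ τ in 𝓝 τ₀, ∀ j ∈ F.erase i, N j τ = N j τ₀ := by
        rw [Finset.eventually_all]
        intro j hj
        exact hN j (Finset.mem_of_mem_erase hj) τ₀ fun h =>
          Finset.ne_of_mem_erase hj (hother j (Finset.mem_of_mem_erase hj) h)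
      have hA : ∀ᶠ s in 𝓝 τ₀, (s ∈ A ↔ (s - τ₀) * inner ℝ (n i) v ≤ 0) := by
        filter_upwards [hcont.continuousAt.eventually_mem
          (Metric.ball_mem_nhds (x + τ₀ • v) hr)] with s hs
        rw [← inner_smul_right, sub_smul, ← add_sub_add_left_eq_sub (s • v) (τ₀ • v) x]
        exact hball _ hs
      have hNi : ∀ τ, N i τ = if τ₀ ≤ τ then 1 else 0 := fun τ => by
        have : (∃ c ≤ τ, x + c • v ∈ e i) ↔ τ₀ ≤ τ :=
          ⟨fun ⟨c', h1, h2⟩ => huniq i hi _ _ h2 hie ▸ h1, fun h => ⟨τ₀, h, hie⟩⟩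
        simp only [N, this]
      -- On entering, `R` and `N i` both jump from 0 to 1 and the sign is negative, so the constant
      -- is 0. On leaving, `R` drops as `N i` rises, so the constant is 1.
      have hmain : ∃ C : ℝ, ∀ᶠ τ in 𝓝 τ₀, R τ + Real.sign (inner ℝ (n i) v) * N i τ = C := by
        rcases lt_or_gt_of_ne hne with hneg | hpos
        · refine ⟨0, ?_⟩
          have hA' : ∀ᶠ s in 𝓝 τ₀, (s ∈ A ↔ τ₀ ≤ s) := hA.mono fun s hs => by
            rw [hs]
            constructor <;> intro h <;> nlinarith
          filter_upwards [eventually_right_iff_le hA'] with τ hτ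
          simp only [R, hτ, hNi, Real.sign_of_neg hneg]
          split_ifs <;> norm_num
        · refine ⟨1, ?_⟩
          have hA' : ∀ᶠ s in 𝓝 τ₀, (s ∈ A ↔ s ≤ τ₀) := hA.mono fun s hs => by
            rw [hs]
            constructor <;> intro h <;> nlinarith
          filter_upwards [eventually_right_iff_lt hA'] with τ hτ
          simp only [R, hτ, hNi, Real.sign_of_pos hpos]
          rcases lt_or_ge τ τ₀ with h | h
          · simp [h, not_le.2 h]
          · simp [h, not_lt.2 h]
      obtain ⟨C, hC⟩ := hmain
      filter_upwards [hC, hrest] with τ h1 h2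
      simp only [G]
      rw [← Finset.add_sum_erase F _ hi, ← Finset.add_sum_erase F _ hi, ← add_assoc, ← add_assoc,
        h1, hC.self_of_nhds]
      congr 1
      exact Finset.sum_congr rfl fun j hj => by rw [h2 j hj]
    · have hrest : ∀ᶠ τ in 𝓝 τ₀, ∀ j ∈ F, N j τ = N j τ₀ := by
        rw [Finset.eventually_all]
        intro j hj
        refine hN j hj τ₀ fun h => hf ?_
        rw [hfr]
        exact Set.mem_biUnion hj h
      filter_upwards [hR τ₀ hf, hrest] with τ h1 h2
      simp only [G]
      rw [h1, (hR τ₀ hf).self_of_nhds]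
      congr 1
      exact Finset.sum_congr rfl fun j hj => by rw [h2 j hj]
  have hconst : ∀ τ τ', G τ = G τ' := fun τ τ' =>
    ((IsLocallyConstant.iff_eventually_eq G).2 hloc).apply_eq_of_isPreconnected
      isPreconnected_univ trivial trivial
  obtain ⟨τ₁, hτ₁⟩ : ∃ τ₁ : ℝ, ∀ τ ≤ τ₁, x + τ • v ∉ K := by
    obtain ⟨C, hC⟩ := hK.isBounded.exists_norm_le
    have hvpos : 0 < ‖v‖ := norm_pos_iff.2 hv
    refine ⟨-((C + ‖x‖ + 1) / ‖v‖), fun τ hτ hmem => ?_⟩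
    have h1 := hC _ hmem
    have h2 : ‖τ • v‖ ≤ ‖x + τ • v‖ + ‖x‖ := by
      have := norm_sub_le (x + τ • v) x
      rwa [add_sub_cancel_left] at this
    rw [norm_smul, Real.norm_eq_abs] at h2
    have h3 : (C + ‖x‖ + 1) / ‖v‖ ≤ |τ| := (by linarith : _ ≤ -τ).trans (neg_le_abs τ)
    rw [div_le_iff₀ hvpos] at h3
    linarith
  -- Far back on the line, nothing has been crossed. The shift by 1 leaves room for a right
  -- neighbourhood still outside `K`.
  have hzero : G (τ₁ - 1) = 0 := by
    have hR0 : R (τ₁ - 1) = 0 := by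
      refine if_neg fun h => ?_
      obtain ⟨s, hs, hs'⟩ := (h.and ((eventually_lt_nhds
        (by linarith : τ₁ - 1 < τ₁)).filter_mono nhdsWithin_le_nhds)).exists
      exact hτ₁ s hs'.le hs
    simp only [G, hR0, zero_add]
    refine Finset.sum_eq_zero fun i hi => ?_
    have : N i (τ₁ - 1) = 0 := by
      refine if_neg fun ⟨c, hc, hce⟩ => ?_
      refine hτ₁ c (by linarith) (hK.isClosed.frontier_subset ?_)
      rw [hfr]
      exact Set.mem_biUnion hi hce
    rw [this, mul_zero]
  have h0 : G 0 = 0 := (hconst 0 _).trans hzero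
  have hR0 : R 0 = K.indicator (fun _ => (1 : ℝ)) x := by
    have := (hR 0 (by simpa using hx)).self_of_nhds
    rw [this, Set.indicator_apply]
    simp
  have hN0 : ∀ i, N i 0 = {x | ∃ c ≤ (0 : ℝ), x + c • v ∈ e i}.indicator (fun _ => (1 : ℝ)) x :=
    fun i => by
      rw [Set.indicator_apply]
      rfl
  simp only [G, hN0] at h0
  rw [← hR0]
  exact eq_neg_of_add_eq_zero_left h0

end Line

/-! ## Integration over the region swept by a flat face -/

/-- Orthogonal coordinates `(s, y) ↦ φ_lin y + s n` adapted to a flat face. -/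
theorem exists_linearIsometryEquiv_of_normal {m : ℕ} (L : Vec m →ₗᵢ[ℝ] Vec (m + 1))
    {n : Vec (m + 1)} (hn1 : ‖n‖ = 1) (hn : ∀ u, inner ℝ n (L u) = 0) :
    ∃ Φ : WithLp 2 (ℝ × Vec m) ≃ₗᵢ[ℝ] Vec (m + 1), ∀ p, Φ p = L p.snd + p.fst • n := by
  let Λ : WithLp 2 (ℝ × Vec m) →ₗ[ℝ] Vec (m + 1) :=
    { toFun := fun p => L p.snd + p.fst • n
      map_add' := fun p q => by
        simp only [WithLp.add_snd, WithLp.add_fst, map_add, add_smul]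
        abel
      map_smul' := fun c p => by
        simp only [WithLp.smul_snd, WithLp.smul_fst, map_smul, smul_eq_mul, mul_smul, smul_add,
          RingHom.id_apply] }
  have hΛ : ∀ p, ‖Λ p‖ = ‖p‖ := fun p => by
    have h1 : ‖Λ p‖ ^ 2 = ‖p‖ ^ 2 := by
      change ‖L p.snd + p.fst • n‖ ^ 2 = _
      rw [norm_add_sq_real, inner_smul_right, real_inner_comm, hn, mul_zero, mul_zero, add_zero,
        L.norm_map, norm_smul, hn1, mul_one, WithLp.prod_norm_sq_eq_of_L2]
      ring
    exact (sq_eq_sq₀ (norm_nonneg _) (norm_nonneg _)).1 h1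
  let Λ' : WithLp 2 (ℝ × Vec m) →ₗᵢ[ℝ] Vec (m + 1) := ⟨Λ, hΛ⟩
  have hfin : Module.finrank ℝ (WithLp 2 (ℝ × Vec m)) = Module.finrank ℝ (Vec (m + 1)) := by
    rw [(WithLp.linearEquiv 2 ℝ (ℝ × Vec m)).finrank_eq, Module.finrank_prod]
    simp [add_comm]
  exact ⟨Λ'.toLinearIsometryEquiv hfin, fun p => rfl⟩

/-- In orthogonal coordinates adapted to the face, the map is a scaling of `s` by `⟪n, v⟫`, a shear
along the face, an isometry and a translation. Only the scaling changes volume, whence the weight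
`|⟪n, v⟫|`. -/
theorem measurePreserving_sweep {m : ℕ} (φ : Vec m →ᵃⁱ[ℝ] Vec (m + 1))
    {n : Vec (m + 1)} (hn1 : ‖n‖ = 1) (hn : ∀ u, inner ℝ n (φ.linearIsometry u) = 0)
    {v : Vec (m + 1)} (hv : inner ℝ n v ≠ 0) :
    MeasurePreserving (fun p : ℝ × Vec m => φ p.2 + p.1 • v)
      ((ENNReal.ofReal |inner ℝ n v| • (volume : Measure ℝ)).prod volume) volume := by
  obtain ⟨Φ, hΦ⟩ := exists_linearIsometryEquiv_of_normal φ.linearIsometry hn1 hn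
  obtain ⟨q, hq⟩ := Φ.surjective v
  rw [hΦ] at hq
  have hα : inner ℝ n v = q.fst := by
    rw [← hq, inner_add_right, hn, zero_add, inner_smul_right, real_inner_self_eq_norm_sq, hn1]
    simp
  rw [hα] at hv ⊢
  have h1 : MeasurePreserving (fun s : ℝ => q.fst * s)
      (ENNReal.ofReal |q.fst| • (volume : Measure ℝ)) volume :=
    ⟨measurable_const_mul _, by rw [Measure.map_smul, Real.smul_map_volume_mul_left hv]⟩
  have h2 : MeasurePreserving (fun p : ℝ × Vec m => (q.fst * p.1, p.2 + p.1 • q.snd))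
      ((ENNReal.ofReal |q.fst| • (volume : Measure ℝ)).prod volume) (volume.prod volume) :=
    h1.skew_product (g := fun s y => y + s • q.snd) (by fun_prop)
      (ae_of_all _ fun s => map_add_right_eq_self volume (s • q.snd))
  have h3 : MeasurePreserving (fun p : ℝ × Vec m => (WithLp.toLp 2 p : WithLp 2 (ℝ × Vec m)))
      (volume.prod volume) volume := WithLp.volume_preserving_toLp _ _
  have h4 : MeasurePreserving (fun x : Vec (m + 1) => x + φ 0) volume volume :=
    measurePreserving_add_right volume (φ 0)
  have h5 := h4.comp (Φ.measurePreserving.comp (h3.comp h2))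
  convert h5 using 1
  funext p
  simp only [Function.comp_apply, hΦ]
  rw [map_eq_add_linear φ p.2, WithLp.toLp_snd, WithLp.toLp_fst, map_add, map_smul, ← hq]
  simp only [smul_add, smul_smul, mul_comm p.1]
  abel

theorem setIntegral_sweep {m : ℕ} (φ : Vec m →ᵃⁱ[ℝ] Vec (m + 1))
    {n : Vec (m + 1)} (hn1 : ‖n‖ = 1) (hn : ∀ u, inner ℝ n (φ.linearIsometry u) = 0)
    {v : Vec (m + 1)} (hv : inner ℝ n v ≠ 0) {D : Set (Vec m)} {g : Vec (m + 1) → ℝ}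
    (hg : Integrable g) :
    ∫ x in {x | ∃ c ≤ (0 : ℝ), x + c • v ∈ φ '' D}, g x =
      |inner ℝ n v| * ∫ y in D, ∫ s in Set.Ici (0 : ℝ), g (φ y + s • v) := by
  have hmp := measurePreserving_sweep φ hn1 hn hv
  have hinj : Function.Injective fun p : ℝ × Vec m => φ p.2 + p.1 • v := by
    rintro ⟨s, y⟩ ⟨s', y'⟩ h
    simp only at h
    have h1 := congrArg (inner ℝ n) h
    rw [inner_add_right, inner_add_right, inner_normal_chart hn y, inner_normal_chart hn y',
      add_right_inj, inner_smul_right, inner_smul_right] at h1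
    have h2 : s = s' := mul_right_cancel₀ hv h1
    subst h2
    rw [φ.injective (add_right_cancel h)]
  have hcont : Continuous fun p : ℝ × Vec m => φ p.2 + p.1 • v :=
    (φ.continuous.comp continuous_snd).add (continuous_fst.smul continuous_const)
  have hemb : MeasurableEmbedding fun p : ℝ × Vec m => φ p.2 + p.1 • v :=
    hcont.measurableEmbedding hinj
  -- Because each swept point has unique coordinates, the half-cylinder `φ '' D + [0, ∞) v`
  -- corresponds exactly to `[0, ∞) × D`.
  have hpre : (fun p : ℝ × Vec m => φ p.2 + p.1 • v) ⁻¹'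
      {x | ∃ c ≤ (0 : ℝ), x + c • v ∈ φ '' D} = Set.Ici 0 ×ˢ D := by
    ext ⟨s, y⟩
    constructor
    · rintro ⟨c, hc, z, hz, hzy⟩
      have h1 : (fun p : ℝ × Vec m => φ p.2 + p.1 • v) (0, z) =
          (fun p : ℝ × Vec m => φ p.2 + p.1 • v) (s + c, y) := by
        simp only [zero_smul, add_zero, hzy, add_smul]
        abel
      have h2 := Prod.ext_iff.1 (hinj h1)
      simp only at h2
      refine ⟨?_, h2.2 ▸ hz⟩
      have h3 := h2.1
      change 0 ≤ s
      linarith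
    · rintro ⟨hs, hy⟩
      refine ⟨-s, neg_nonpos.2 hs, y, hy, ?_⟩
      simp
  have hint : Integrable (fun p : ℝ × Vec m => g (φ p.2 + p.1 • v))
      ((ENNReal.ofReal |inner ℝ n v| • (volume : Measure ℝ)).prod volume) :=
    (hmp.integrable_comp_emb hemb).2 hg
  rw [← hmp.setIntegral_preimage_emb hemb, hpre, ← setIntegral_prod_swap,
    setIntegral_prod _ (show IntegrableOn (fun z : Vec m × ℝ => g (φ z.swap.2 + z.swap.1 • v)) _ _
      from hint.swap.integrableOn), ← integral_const_mul]
  refine integral_congr_ae (ae_of_all _ fun y => ?_)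
  simp only [Prod.swap_prod_mk, Measure.restrict_smul]
  rw [integral_smul_measure, ENNReal.toReal_ofReal (abs_nonneg _), smul_eq_mul]

/-- An isometry carries Lebesgue measure of `ℝ^m` to `m`-dimensional Hausdorff measure on its range.
-/
theorem setIntegral_image_chart {m d : ℕ} (φ : Vec m →ᵃⁱ[ℝ] Vec d) (D : Set (Vec m))
    (ψ : Vec d → ℝ) : ∫ x in φ '' D, ψ x ∂μHE[m] = ∫ y in D, ψ (φ y) := by
  have hemb : MeasurableEmbedding φ := φ.continuous.measurableEmbedding φ.injective
  have hmp : MeasurePreserving φ (volume : Measure (Vec m))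
      ((μHE[m] : Measure (Vec d)).restrict (Set.range φ)) :=
    ⟨φ.continuous.measurable, by
      rw [← φ.isometry.map_euclideanHausdorffMeasure,
        EuclideanSpace.euclideanHausdorffMeasure_eq_volume]⟩
  have h := hmp.setIntegral_preimage_emb hemb ψ (φ '' D)
  rw [Set.preimage_image_eq _ φ.injective, Measure.restrict_restrict_of_subset
    (Set.image_subset_range _ _)] at h
  exact h.symm

/-- Sweeping a flat face in the direction `v` and integrating a derivative in this direction. -/
theorem setIntegral_sweep_fderiv {m : ℕ} (φ : Vec m →ᵃⁱ[ℝ] Vec (m + 1))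
    {n : Vec (m + 1)} (hn1 : ‖n‖ = 1) (hn : ∀ u, inner ℝ n (φ.linearIsometry u) = 0)
    {v : Vec (m + 1)} (hv : inner ℝ n v ≠ 0) {D : Set (Vec m)} {ψ : Vec (m + 1) → ℝ}
    (hψ : ContDiff ℝ 1 ψ) (hc : HasCompactSupport ψ) :
    ∫ x in {x | ∃ c ≤ (0 : ℝ), x + c • v ∈ φ '' D}, fderiv ℝ ψ x v =
      -(|inner ℝ n v| * ∫ x in φ '' D, ψ x ∂μHE[m]) := by
  have hcont : Continuous fun x => fderiv ℝ ψ x v :=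
    (hψ.continuous_fderiv one_ne_zero).clm_apply continuous_const
  have hcs : HasCompactSupport fun x => fderiv ℝ ψ x v := hc.fderiv_apply ℝ v
  have hv0 : v ≠ 0 := fun h => hv (by rw [h, inner_zero_right])
  rw [setIntegral_sweep φ hn1 hn hv (hcont.integrable_of_hasCompactSupport hcs),
    setIntegral_image_chart, ← mul_neg, ← integral_neg]
  congr 1
  refine integral_congr_ae (ae_of_all _ fun y => ?_)
  have hline : ContDiff ℝ 1 fun s : ℝ => φ y + s • v := by fun_prop
  have hline' : ∀ s : ℝ, HasDerivAt (fun s : ℝ => φ y + s • v) v s := fun s => by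
    simpa using ((hasDerivAt_id s).smul_const v).const_add (φ y)
  have hce : Topology.IsClosedEmbedding fun s : ℝ => φ y + s • v :=
    (Homeomorph.addLeft (φ y)).isClosedEmbedding.comp (isClosedEmbedding_smul_left hv0)
  -- Fundamental theorem of calculus on a half-line: compact support removes the contribution at
  -- infinity, leaving minus the value on the face.
  have h1 := HasCompactSupport.integral_Ioi_deriv_eq (hψ.comp hline)
    (hc.comp_isClosedEmbedding hce) 0
  simp only [Function.comp_apply, zero_smul, add_zero] at h1
  beta_reduce
  rw [integral_Ici_eq_integral_Ioi, ← h1]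
  refine integral_congr_ae (ae_of_all _ fun s => ?_)
  exact (((hψ.differentiable one_ne_zero _).hasFDerivAt.comp_hasDerivAt s (hline' s)).deriv).symm

/-! ## The divergence theorem on an element -/

namespace Mesh

theorem mem_facesOf {d : ℕ} {Ω : Set (Vec d)} {M : Mesh Ω} {T : M.elements} {e : M.faces} :
    e ∈ M.facesOf T ↔ (e : Set (Vec d)) ⊆ frontier (T : Set (Vec d)) := by
  simp [facesOf]

theorem frontier_eq_iUnion {d : ℕ} {Ω : Set (Vec d)} (M : Mesh Ω) (T : M.elements) :
    frontier (T : Set (Vec d)) = ⋃ e ∈ M.facesOf T, (e : Set (Vec d)) := by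
  rw [M.frontier_eq T T.2]
  ext x
  simp [mem_facesOf]
  tauto

theorem isOutwardNormal_normal {d : ℕ} {Ω : Set (Vec d)} {M : Mesh Ω} {T : M.elements}
    {e : M.faces} (he : e ∈ M.facesOf T) {x : Vec d}
    (hx : x ∈ intrinsicInterior ℝ (e : Set (Vec d))) :
    IsOutwardNormal (T : Set (Vec d)) x (M.normal T e) := by
  have h := M.exists_normal T T.2 e e.2 (mem_facesOf.1 he)
  rw [normal, faceNormal, dif_pos h]
  exact h.choose_spec x hx

variable {m : ℕ} {Ω : Set (Vec (m + 1))} (M : Mesh Ω)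

theorem exists_chart {T : M.elements} {e : M.faces} (he : e ∈ M.facesOf T) :
    ∃ (D : Set (Vec m)) (φ : Vec m →ᵃⁱ[ℝ] Vec (m + 1)), IsPolytope D ∧
      (e : Set (Vec (m + 1))) = φ '' D ∧
      φ '' interior D ⊆ intrinsicInterior ℝ (e : Set (Vec (m + 1))) ∧
      ‖M.normal T e‖ = 1 ∧ ∀ u, inner ℝ (M.normal T e) (φ.linearIsometry u) = 0 := by
  obtain ⟨D, φ, hD, heD, hint⟩ := (M.isFlatFace e e.2).exists_chart
  have hne : (interior D).Nonempty := hD.isConnected_interior.nonempty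
  have hn : ∀ x ∈ φ '' interior D, IsOutwardNormal (T : Set (Vec (m + 1))) x (M.normal T e) :=
    fun x hx => isOutwardNormal_normal he (hint hx)
  refine ⟨D, φ, hD, heD, hint, ?_, inner_normal_linear_eq_zero hne ?_ hn⟩
  · obtain ⟨y, hy⟩ := hne
    exact (hn (φ y) ⟨y, hy, rfl⟩).1
  · rw [← heD]
    exact (mem_facesOf.1 he).trans (M.isPolytope T T.2).isCompact.isClosed.frontier_subset

/-- Almost every line of direction `v` meets the faces of `T` only in their relative interiors, and
transversally. -/
theorem ae_line_regular (T : M.elements) (v : Vec (m + 1)) :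
    ∀ᵐ x : Vec (m + 1), ∀ e ∈ M.facesOf T, ∀ τ : ℝ, x + τ • v ∈ (e : Set (Vec (m + 1))) →
      x + τ • v ∈ intrinsicInterior ℝ (e : Set (Vec (m + 1))) ∧
        inner ℝ (M.normal T e) v ≠ 0 := by
  rw [Finset.eventually_all]
  intro e he
  obtain ⟨D, φ, hD, heD, hint, hn1, hn⟩ := M.exists_chart he
  have hn0 : M.normal T e ≠ 0 := by
    rw [← norm_ne_zero_iff, hn1]
    exact one_ne_zero
  filter_upwards [ae_line_meets_interior hD hn0 hn v] with x hx τ hτ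
  rw [heD] at hτ
  exact ⟨hint (hx τ hτ).1, (hx τ hτ).2⟩

theorem ae_notMem_frontier (T : M.elements) :
    ∀ᵐ x : Vec (m + 1), x ∉ frontier (T : Set (Vec (m + 1))) := by
  have h : ∀ᵐ x : Vec (m + 1), ∀ e ∈ M.facesOf T, x ∉ (e : Set (Vec (m + 1))) := by
    rw [Finset.eventually_all]
    intro e he
    obtain ⟨D, φ, hD, heD, hint, hn1, hn⟩ := M.exists_chart he
    have hn0 : M.normal T e ≠ 0 := by
      rw [← norm_ne_zero_iff, hn1]
      exact one_ne_zero
    filter_upwards [ae_inner_ne hn0 (inner ℝ (M.normal T e) (φ 0))] with x hx hxe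
    rw [heD] at hxe
    obtain ⟨y, -, rfl⟩ := hxe
    exact hx (inner_normal_chart hn y)
  filter_upwards [h] with x hx hxf
  rw [M.frontier_eq_iUnion] at hxf
  obtain ⟨e, he, hxe⟩ := Set.mem_iUnion₂.1 hxf
  exact hx e he hxe

-- Divergence theorem in a fixed direction: the crossing formula writes the indicator of `T` as a
-- signed sum of indicators of the half-cylinders swept by its faces, and each half-cylinder
-- integrates to a face integral.
open scoped Pointwise in
theorem setIntegral_fderiv (T : M.elements) {ψ : Vec (m + 1) → ℝ}
    (hψ : ContDiff ℝ 1 ψ) (hc : HasCompactSupport ψ) (v : Vec (m + 1)) :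
    ∫ x in (T : Set (Vec (m + 1))), fderiv ℝ ψ x v =
      ∑ e ∈ M.facesOf T, inner ℝ (M.normal T e) v *
        ∫ x in (e : Set (Vec (m + 1))), ψ x ∂μHE[m] := by
  rcases eq_or_ne v 0 with rfl | hv
  · simp
  have hK := (M.isPolytope T T.2).isCompact
  have hint : Integrable fun x => fderiv ℝ ψ x v :=
    ((hψ.continuous_fderiv one_ne_zero).clm_apply
      continuous_const).integrable_of_hasCompactSupport (hc.fderiv_apply ℝ v)
  let C (e : M.faces) : Set (Vec (m + 1)) :=
    {x | ∃ c ≤ (0 : ℝ), x + c • v ∈ (e : Set (Vec (m + 1)))}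
  have hflat : ∀ e ∈ M.facesOf T, ∀ y ∈ (e : Set (Vec (m + 1))), ∀ z ∈ (e : Set (Vec (m + 1))),
      inner ℝ (M.normal T e) (y - z) = 0 := by
    intro e he y hy z hz
    obtain ⟨D, φ, hD, heD, -, -, hn⟩ := M.exists_chart he
    rw [heD] at hy hz
    obtain ⟨y, -, rfl⟩ := hy
    obtain ⟨z, -, rfl⟩ := hz
    rw [inner_sub_right, inner_normal_chart hn y, inner_normal_chart hn z, sub_self]
  have hind : ∀ᵐ x : Vec (m + 1), (T : Set (Vec (m + 1))).indicator (fun x => fderiv ℝ ψ x v) x =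
      ∑ e ∈ M.facesOf T, -Real.sign (inner ℝ (M.normal T e) v) *
        (C e).indicator (fun x => fderiv ℝ ψ x v) x := by
    filter_upwards [M.ae_line_regular T v, M.ae_notMem_frontier T] with x hx hxf
    have h := indicator_eq_neg_sum_sign hK (M.facesOf T) (fun e => (e : Set (Vec (m + 1))))
      (M.normal T) (M.frontier_eq_iUnion T) hflat hv hxf fun e he τ hτ =>
        ⟨isOutwardNormal_normal he (hx e he τ hτ).1, (hx e he τ hτ).2, fun e' he' hτ' => by
          by_contra hne
          exact Set.disjoint_left.1 (M.disjoint_faces e' e'.2 e e.2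
            fun h => hne (Subtype.ext h)) (hx e' he' τ hτ').1 (hx e he τ hτ).1⟩
    have hmul : ∀ A : Set (Vec (m + 1)), A.indicator (fun x => fderiv ℝ ψ x v) x =
        A.indicator (fun _ => (1 : ℝ)) x * fderiv ℝ ψ x v := fun A => by
      classical
      simp [Set.indicator_apply]
    simp only [hmul]
    rw [h, neg_mul, Finset.sum_mul, ← Finset.sum_neg_distrib]
    exact Finset.sum_congr rfl fun e _ => by ring
  have hterm : ∀ e ∈ M.facesOf T,
      Integrable (fun x => -Real.sign (inner ℝ (M.normal T e) v) *
        (C e).indicator (fun x => fderiv ℝ ψ x v) x) ∧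
      ∫ x, -Real.sign (inner ℝ (M.normal T e) v) *
        (C e).indicator (fun x => fderiv ℝ ψ x v) x = inner ℝ (M.normal T e) v *
          ∫ x in (e : Set (Vec (m + 1))), ψ x ∂μHE[m] := by
    intro e he
    by_cases hne : inner ℝ (M.normal T e) v = 0
    · simp [hne]
    obtain ⟨D, φ, hD, heD, -, hn1, hn⟩ := M.exists_chart he
    -- The half-cylinder is the sum of a compact set and a closed ray, hence closed.
    have hmeas : MeasurableSet (C e) := by
      have hcl : IsClosed (C e) := by
        have : C e = (e : Set (Vec (m + 1))) + (fun s : ℝ => s • v) '' Set.Ici 0 := by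
          ext x
          constructor
          · rintro ⟨c, hc, hx⟩
            exact ⟨_, hx, _, ⟨-c, neg_nonneg.2 hc, rfl⟩, by simp⟩
          · rintro ⟨y, hy, _, ⟨s, hs, rfl⟩, rfl⟩
            exact ⟨-s, neg_nonpos.2 hs, by simpa using hy⟩
        rw [this]
        exact ((isClosedEmbedding_smul_left hv).isClosedMap _ isClosed_Ici).add_left_of_isCompact
          (M.isFlatFace e e.2).isCompact
      exact hcl.measurableSet
    refine ⟨(hint.indicator hmeas).const_mul _, ?_⟩
    rw [integral_const_mul, integral_indicator hmeas]
    simp only [C, heD]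
    rw [setIntegral_sweep_fderiv φ hn1 hn hne hψ hc, neg_mul_neg, ← mul_assoc]
    congr 1
    -- The crossing sign times the Jacobian `|⟪n, v⟫|` restores `⟪n, v⟫`.
    rcases lt_or_gt_of_ne hne with h | h
    · rw [Real.sign_of_neg h, abs_of_neg h]
      ring
    · rw [Real.sign_of_pos h, abs_of_pos h, one_mul]
  rw [← integral_indicator hK.measurableSet, integral_congr_ae hind,
    integral_finsetSum _ fun e he => (hterm e he).1]
  exact Finset.sum_congr rfl fun e he => (hterm e he).2

/-- The divergence theorem for polynomials on an element. -/
theorem setIntegral_pev_pderiv (T : M.elements) (p : Poly (m + 1)) (j : Fin (m + 1)) :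
    ∫ x in (T : Set (Vec (m + 1))), pev (MvPolynomial.pderiv j p) x =
      ∑ e ∈ M.facesOf T, M.normal T e j * ∫ x in (e : Set (Vec (m + 1))), pev p x ∂μHE[m] := by
  have hK := (M.isPolytope T T.2).isCompact
  obtain ⟨R, hR⟩ := hK.isBounded.subset_ball (0 : Vec (m + 1))
  have hR0 : 0 < max R 1 := lt_max_of_lt_right one_pos
  -- The cutoff supplies the compact support and equals 1 near every point of `T`, so neither side
  -- changes. The maximum with 1 keeps the inner radius positive.
  let χ : ContDiffBump (0 : Vec (m + 1)) := ⟨max R 1, max R 1 + 1, hR0, lt_add_one _⟩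
  have hone : ∀ x ∈ (T : Set (Vec (m + 1))), (fun x => χ x * pev p x) =ᶠ[𝓝 x] pev p := by
    intro x hx
    have hx' : x ∈ Metric.ball (0 : Vec (m + 1)) χ.rIn :=
      Metric.ball_subset_ball (le_max_left R 1) (hR hx)
    filter_upwards [χ.eventuallyEq_one_of_mem_ball hx'] with y hy
    simp [hy]
  have h := M.setIntegral_fderiv T (ψ := fun x => χ x * pev p x)
    (χ.contDiff.mul (contDiff_pev p)) χ.hasCompactSupport.mul_right (EuclideanSpace.single j 1)
  rw [setIntegral_congr_fun hK.measurableSet fun x hx => by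
    rw [(hone x hx).fderiv_eq, fderiv_pev_single]] at h
  rw [h]
  refine Finset.sum_congr rfl fun e he => ?_
  congr 1
  · simp [EuclideanSpace.inner_single_right]
  · refine setIntegral_congr_fun (M.isFlatFace e e.2).isCompact.measurableSet fun x hx => ?_
    exact (hone x (hK.isClosed.frontier_subset (mem_facesOf.1 he hx))).self_of_nhds

end Mesh

/-! ## Weak gradients of functions with compatible traces -/

/-- The integral of a polynomial over a compact set, as a linear functional. -/
def polyInt {d : ℕ} (ν : Measure (Vec d)) {A : Set (Vec d)} (hA : IsCompact A) (hν : ν A ≠ ⊤) :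
    Poly d →ₗ[ℝ] ℝ :=
  (innerₗ _ (polyLp ν hA hν 1)).comp (polyLp ν hA hν)

theorem polyInt_apply {d : ℕ} (ν : Measure (Vec d)) {A : Set (Vec d)} (hA : IsCompact A)
    (hν : ν A ≠ ⊤) (p : Poly d) : polyInt ν hA hν p = ∫ x in A, pev p x ∂ν := by
  have h := inner_polyLp ν hA hν 1 p
  rwa [one_mul] at h

namespace Mesh

variable {d : ℕ} {Ω : Set (Vec d)} (M : Mesh Ω)

/-- The integral of a polynomial over an element. -/
def elemInt (T : M.elements) : Poly d →ₗ[ℝ] ℝ :=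
  polyInt volume (M.isPolytope T T.2).isCompact (M.isPolytope T T.2).isCompact.measure_lt_top.ne

/-- The integral of a polynomial over a face. -/
def faceInt (e : M.faces) : Poly d →ₗ[ℝ] ℝ :=
  polyInt (μHE[d - 1]) (M.isFlatFace e e.2).isCompact (M.isFlatFace e e.2).measure_ne_top

theorem inner_elemPoly (T : M.elements) (p q : Poly d) :
    inner ℝ (M.elemPoly T p) (M.elemPoly T q) = M.elemInt T (p * q) :=
  (inner_polyLp _ _ _ p q).trans (polyInt_apply _ _ _ _).symm

theorem inner_elemVec (T : M.elements) (p q : Fin d → Poly d) :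
    inner ℝ (M.elemVec T p) (M.elemVec T q) = M.elemInt T (∑ i, p i * q i) :=
  (inner_vecLp _ _ _ p q).trans (polyInt_apply _ _ _ _).symm

theorem inner_faceVec (e : M.faces) (p q : Fin d → Poly d) :
    inner ℝ (M.faceVec e p) (M.faceVec e q) = M.faceInt e (∑ i, p i * q i) :=
  (inner_vecLp _ _ _ p q).trans (polyInt_apply _ _ _ _).symm

theorem inner_Qb (k : ℕ) (e : M.faces) (g : Lp (Vec d) 2 (surf (e : Set (Vec d))))
    {h : Lp (Vec d) 2 (surf (e : Set (Vec d)))} (hh : h ∈ M.faceSpace k e) :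
    inner ℝ (M.Qb k e g) h = inner ℝ g h := by
  rw [Qb, Submodule.inner_starProjection_left_eq_right, Submodule.starProjection_eq_self_iff.2 hh]

theorem mulNormal_mem {r : ℕ} {Φ : Matrix (Fin d) (Fin d) (Poly d)} (hΦ : ∀ i j, Φ i j ∈ P d r)
    (n : Vec d) : mulNormal Φ n ∈ PVec d r := by
  rw [PVec, Submodule.mem_pi]
  exact fun i _ => Submodule.sum_mem _ fun j _ => Submodule.smul_mem _ _ (hΦ i j)

theorem faceVec_mem_of_PVec {k : ℕ} (e : M.faces) {p : Fin d → Poly d} (hp : p ∈ PVec d (k - 1)) :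
    M.faceVec e p ∈ M.faceSpace k e :=
  Submodule.mem_sup_left (Submodule.mem_map_of_mem hp)

theorem faceVec_mem_of_RM (k : ℕ) (e : M.faces) {p : Fin d → Poly d} (hp : p ∈ RM d) :
    M.faceVec e p ∈ M.faceSpace k e :=
  Submodule.mem_sup_right (Submodule.mem_map_of_mem hp)

theorem isWeakGrad_gradW (k : ℕ) (v : M.Pairs) (T : M.elements) :
    M.IsWeakGrad (k - 1) T (M.elemVec T (v.1 T)) v.2 (M.gradW k v T) :=
  (M.existsUnique_weakGrad _ _ _ _).choose_spec.1

theorem isWeakDiv_divW (k : ℕ) (v : M.Pairs) (T : M.elements) :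
    M.IsWeakDiv (k - 1) T (M.elemVec T (v.1 T)) v.2 (M.divW k v T) :=
  (M.existsUnique_weakDiv _ _ _ _).choose_spec.1

/-- Uniqueness in the defining relation is the only tool needed to compute weak gradients; linearity
also follows from it. -/
theorem gradW_eq_of_isWeakGrad {k : ℕ} {v : M.Pairs} {T : M.elements}
    {G : Matrix (Fin d) (Fin d) (Poly d)}
    (h : M.IsWeakGrad (k - 1) T (M.elemVec T (v.1 T)) v.2 G) : M.gradW k v T = G :=
  (M.existsUnique_weakGrad _ _ _ _).unique (M.isWeakGrad_gradW k v T) h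

theorem divW_eq_of_isWeakDiv {k : ℕ} {v : M.Pairs} {T : M.elements} {q : Poly d}
    (h : M.IsWeakDiv (k - 1) T (M.elemVec T (v.1 T)) v.2 q) : M.divW k v T = q :=
  (M.existsUnique_weakDiv _ _ _ _).unique (M.isWeakDiv_divW k v T) h

theorem elemInt_pderiv {m : ℕ} {Ω : Set (Vec (m + 1))} (M : Mesh Ω) (T : M.elements)
    (p : Poly (m + 1)) (j : Fin (m + 1)) : M.elemInt T (MvPolynomial.pderiv j p) =
      ∑ e ∈ M.facesOf T, M.normal T e j * M.faceInt e p := by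
  rw [elemInt, polyInt_apply, M.setIntegral_pev_pderiv T p j]
  refine Finset.sum_congr rfl fun e _ => ?_
  rw [faceInt, polyInt_apply]
  rfl

/-- If `v_b = Q_b v₀` on the boundary of `T`, the weak gradient is the gradient of `v₀`. -/
theorem gradW_eq_grad {m : ℕ} {Ω : Set (Vec (m + 1))} (M : Mesh Ω) {k : ℕ} {v : M.Pairs}
    {T : M.elements} (hv : v.1 T ∈ PVec (m + 1) k)
    (hb : ∀ e ∈ M.facesOf T, v.2 e = M.Qb k e (M.faceVec e (v.1 T))) :
    M.gradW k v T = Matrix.of fun i j => MvPolynomial.pderiv j (v.1 T i) := by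
  refine M.gradW_eq_of_isWeakGrad ⟨fun i j => ?_, fun Φ hΦ => ?_⟩
  · rw [PVec, Submodule.mem_pi] at hv
    exact pderiv_mem_P (hv i trivial) j
  -- The normal is constant on a face, so `Φ n` lies in `V_{k-1}(e)`. As `Q_b` is a self-adjoint
  -- projection, it disappears in this pairing.
  · have hface : ∀ e ∈ M.facesOf T,
        inner ℝ (v.2 e) (M.faceVec e (mulNormal Φ (M.normal T e))) =
          ∑ i, ∑ j, M.normal T e j * M.faceInt e (v.1 T i * Φ i j) := by
      intro e he
      rw [hb e he, M.inner_Qb k e _ (M.faceVec_mem_of_PVec e (mulNormal_mem hΦ _)),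
        M.inner_faceVec]
      simp only [mulNormal, map_sum, Finset.mul_sum, mul_smul_comm, map_smul, smul_eq_mul]
    rw [Finset.sum_congr rfl hface, M.inner_elemVec, Finset.sum_comm, eq_neg_add_iff_add_eq]
    simp only [matInner, divRow, M.inner_elemPoly, Finset.mul_sum, map_sum, Matrix.of_apply]
    rw [← Finset.sum_add_distrib]
    refine Finset.sum_congr rfl fun i _ => ?_
    rw [Finset.sum_comm, ← Finset.sum_add_distrib]
    refine Finset.sum_congr rfl fun j _ => ?_
    rw [← M.elemInt_pderiv T, ← map_add, MvPolynomial.pderiv_mul, add_comm (v.1 T i * _)]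

/-! ## Positivity of the bilinear form -/

theorem matInner_self_nonneg (T : M.elements) (A : Matrix (Fin d) (Fin d) (Poly d)) :
    0 ≤ M.matInner T A A :=
  Finset.sum_nonneg fun _ _ => Finset.sum_nonneg fun _ _ => real_inner_self_nonneg

theorem eq_zero_of_matInner_self {T : M.elements} {A : Matrix (Fin d) (Fin d) (Poly d)}
    (h : M.matInner T A A = 0) : A = 0 := by
  rw [matInner, Finset.sum_eq_zero_iff_of_nonneg
    fun i _ => Finset.sum_nonneg fun j _ => real_inner_self_nonneg] at h
  ext1 i j
  have := (Finset.sum_eq_zero_iff_of_nonneg fun j _ => real_inner_self_nonneg).1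
    (h i (Finset.mem_univ i)) j (Finset.mem_univ j)
  apply M.elemPoly_injective T
  rw [inner_self_eq_zero.1 this, Matrix.zero_apply, map_zero]

/-- A set with at most one point is Lebesgue null, whereas `T` has nonempty interior. Positivity
makes the stabilizer weight nonzero, so a zero stabilizer forces zero jumps. -/
theorem diam_pos {m : ℕ} {Ω : Set (Vec (m + 1))} (M : Mesh Ω) (T : M.elements) :
    0 < Metric.diam (T : Set (Vec (m + 1))) := by
  have hT := M.isPolytope T T.2
  refine Metric.diam_pos ?_ hT.isCompact.isBounded
  by_contra h
  rw [Set.not_nontrivial_iff] at h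
  have h0 : volume (T : Set (Vec (m + 1))) = 0 := h.measure_zero _
  have h1 := isOpen_interior.measure_pos (volume : Measure (Vec (m + 1)))
    hT.isConnected_interior.nonempty
  exact h1.ne' (measure_mono_null _root_.interior_subset h0)

theorem eq_zero_of_aS_self {m : ℕ} {Ω : Set (Vec (m + 1))} (M : Mesh Ω) {k : ℕ} {mu lam : ℝ}
    (hmu : 0 < mu) (hlam : 0 ≤ lam) {v : M.Pairs} (h : M.aS k mu lam v v = 0) (T : M.elements) :
    M.strainW k v T = 0 ∧ ∀ e ∈ M.facesOf T, M.jump k v T e = 0 := by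
  have h1 : ∀ T ∈ Finset.univ,
      0 ≤ 2 * (mu * M.matInner T (M.strainW k v T) (M.strainW k v T)) := fun T _ =>
    mul_nonneg two_pos.le (mul_nonneg hmu.le (M.matInner_self_nonneg T _))
  have h2 : ∀ T ∈ (Finset.univ : Finset M.elements), 0 ≤ lam *
      inner ℝ (M.elemPoly T (M.divW k v T)) (M.elemPoly T (M.divW k v T)) := fun T _ =>
    mul_nonneg hlam real_inner_self_nonneg
  have h3 : ∀ T ∈ (Finset.univ : Finset M.elements),
      0 ≤ (Metric.diam (T : Set (Vec (m + 1))))⁻¹ *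
        ∑ e ∈ M.facesOf T, inner ℝ (M.jump k v T e) (M.jump k v T e) := fun T _ =>
    mul_nonneg (inv_nonneg.2 Metric.diam_nonneg)
      (Finset.sum_nonneg fun _ _ => real_inner_self_nonneg)
  have s1 := Finset.sum_nonneg h1
  have s2 := Finset.sum_nonneg h2
  have s3 := Finset.sum_nonneg h3
  rw [aS, stab] at h
  have z1 := (Finset.sum_eq_zero_iff_of_nonneg h1).1 (by linarith) T (Finset.mem_univ T)
  have z3 := (Finset.sum_eq_zero_iff_of_nonneg h3).1 (by linarith) T (Finset.mem_univ T)
  constructor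
  · refine M.eq_zero_of_matInner_self (T := T) ?_
    simpa [hmu.ne'] using z1
  · intro e he
    have z4 := (mul_eq_zero.1 z3).resolve_left (inv_ne_zero (M.diam_pos T).ne')
    exact inner_self_eq_zero.1
      ((Finset.sum_eq_zero_iff_of_nonneg fun _ _ => real_inner_self_nonneg).1 z4 e he)

/-- Zero jumps turn the weak strain into the true strain, which then vanishes. The summand `P_RM(e)`
of the face space is what upgrades `v_b = Q_b v₀` to equality of traces. -/
theorem mem_RM_of_aS_self {m : ℕ} {Ω : Set (Vec (m + 1))} (M : Mesh Ω) {k : ℕ} {mu lam : ℝ}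
    (hmu : 0 < mu) (hlam : 0 ≤ lam) {v : M.Pairs} (hv : v ∈ M.V k)
    (h : M.aS k mu lam v v = 0) (T : M.elements) :
    v.1 T ∈ RM (m + 1) ∧ ∀ e ∈ M.facesOf T, v.2 e = M.faceVec e (v.1 T) := by
  obtain ⟨h1, h2⟩ := M.eq_zero_of_aS_self hmu hlam h T
  have hb : ∀ e ∈ M.facesOf T, v.2 e = M.Qb k e (M.faceVec e (v.1 T)) := fun e he =>
    (sub_eq_zero.1 (h2 e he)).symm
  rw [strainW, M.gradW_eq_grad (hv.1 T) hb, smul_eq_zero] at h1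
  have h3 := h1.resolve_left (by norm_num)
  have hRM : v.1 T ∈ RM (m + 1) := mem_RM_of_strain_eq_zero fun i j => by
    have := congrFun (congrFun h3 i) j
    exact this
  refine ⟨hRM, fun e he => ?_⟩
  rw [hb e he, Qb, Submodule.starProjection_eq_self_iff.2 (M.faceVec_mem_of_RM k e hRM)]

end Mesh

/-! ## Rigid motions vanishing on a flat face -/

theorem vev_rigidMotion {d : ℕ} (a : Vec d) (η : Matrix (Fin d) (Fin d) ℝ) (x : Vec d) :
    vev (rigidMotion a η) x = a + Matrix.toEuclideanLin η x := by
  ext i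
  simp [vev, pev, rigidMotion, Matrix.toLpLin_apply, Matrix.mulVec, dotProduct]

theorem inner_toEuclideanLin_of_skew {d : ℕ} {η : Matrix (Fin d) (Fin d) ℝ}
    (hη : η.transpose = -η) (x y : Vec d) :
    inner ℝ (Matrix.toEuclideanLin η x) y = -inner ℝ x (Matrix.toEuclideanLin η y) := by
  rw [← inner_neg_right, ← LinearMap.neg_apply, ← map_neg, ← hη,
    ← Matrix.conjTranspose_eq_transpose_of_trivial, Matrix.toEuclideanLin_conjTranspose_eq_adjoint,
    LinearMap.adjoint_inner_right]

/-- A rigid motion that vanishes on a piece of a hyperplane is zero. -/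
theorem rigidMotion_eq_zero {m : ℕ} {φ : Vec m →ᵃⁱ[ℝ] Vec (m + 1)} {n : Vec (m + 1)}
    (hn1 : ‖n‖ = 1) (hn : ∀ u, inner ℝ n (φ.linearIsometry u) = 0) {U : Set (Vec m)}
    (hU : IsOpen U) (hne : U.Nonempty) {p : Fin (m + 1) → Poly (m + 1)} (hp : p ∈ RM (m + 1))
    (h0 : ∀ y ∈ U, vev p (φ y) = 0) : p = 0 := by
  obtain ⟨a, η, hη, rfl⟩ := hp
  simp only [vev_rigidMotion] at h0
  obtain ⟨y, hy⟩ := hne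
  set N := Matrix.toEuclideanLin η with hN
  -- Subtracting the motion at two points of the face removes the translation and shows that the
  -- linear part kills tangent vectors.
  have h1 : ∀ u, N (φ.linearIsometry u) = 0 := by
    intro u
    have hc : Continuous fun t : ℝ => y + t • u := by fun_prop
    have hi : U ∈ 𝓝 (y + (0 : ℝ) • u) := by
      rw [zero_smul, add_zero]
      exact hU.mem_nhds hy
    have hev := (hc.continuousAt.eventually_mem hi).filter_mono
      (nhdsWithin_le_nhds (s := Set.Ioi (0 : ℝ)))
    obtain ⟨t, ht, ht'⟩ := (hev.and self_mem_nhdsWithin).exists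
    have h2 := h0 _ ht
    rw [← h0 y hy, map_eq_add_linear φ y, map_eq_add_linear φ (y + t • u), map_add, map_add, map_add,
      map_smul, map_smul, map_add] at h2
    have h3 : t • N (φ.linearIsometry u) = 0 := by
      have := sub_eq_zero.2 h2
      rw [← this]
      abel
    exact (smul_eq_zero.1 h3).resolve_left (ne_of_gt ht')
  obtain ⟨Φ, hΦ⟩ := exists_linearIsometryEquiv_of_normal φ.linearIsometry hn1 hn
  -- By skew-symmetry `N n` is orthogonal to `n`, and its pairing with a tangent vector moves `N`
  -- onto that vector, where it vanishes.
  have h2 : N n = 0 := by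
    refine ext_inner_right ℝ fun x => ?_
    obtain ⟨q, rfl⟩ := Φ.surjective x
    have h3 := inner_toEuclideanLin_of_skew hη n n
    rw [← hN, real_inner_comm (N n) n] at h3
    have h4 : inner ℝ (N n) n = 0 := self_eq_neg.1 h3
    rw [hΦ, inner_add_right, inner_smul_right, h4, inner_toEuclideanLin_of_skew hη, ← hN, h1]
    simp
  have h3 : N = 0 := by
    ext1 x
    obtain ⟨q, rfl⟩ := Φ.surjective x
    rw [hΦ, map_add, map_smul, h1, h2]
    simp
  have h4 : η = 0 := by
    rw [hN, map_eq_zero_iff _ (LinearEquiv.injective _)] at h3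
    exact h3
  have h5 := h0 y hy
  rw [h3, LinearMap.zero_apply, add_zero] at h5
  rw [h4, h5]
  funext i
  simp [rigidMotion]

namespace Mesh

variable {m : ℕ} {Ω : Set (Vec (m + 1))} (M : Mesh Ω)

/-- A zero class on the face means that `∫ |p|²` vanishes; by continuity `p` vanishes at every point
of the interior of the chart, and a rigid motion is determined there. -/
theorem eq_zero_of_faceVec_eq_zero {T : M.elements} {e : M.faces} (he : e ∈ M.facesOf T)
    {p : Fin (m + 1) → Poly (m + 1)} (hp : p ∈ RM (m + 1)) (h0 : M.faceVec e p = 0) : p = 0 := by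
  obtain ⟨D, φ, hD, heD, -, hn1, hn⟩ := M.exists_chart he
  have h1 := M.inner_faceVec e p p
  rw [h0, inner_zero_left, faceInt, polyInt_apply] at h1
  change 0 = ∫ x in (e : Set (Vec (m + 1))), pev (∑ i, p i * p i) x ∂μHE[m] at h1
  rw [heD, setIntegral_image_chart] at h1
  have hcont : Continuous fun y => pev (∑ i, p i * p i) (φ y) :=
    (continuous_pev _).comp φ.continuous
  have hnn : ∀ x, 0 ≤ pev (∑ i, p i * p i) x := fun x => by
    rw [pev_sum]
    exact Finset.sum_nonneg fun i _ => by
      rw [pev_mul]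
      exact mul_self_nonneg _
  have h2 : (fun y => pev (∑ i, p i * p i) (φ y)) =ᵐ[volume.restrict D] 0 :=
    (integral_eq_zero_iff_of_nonneg (fun y => hnn _)
      (hcont.continuousOn.integrableOn_compact hD.isCompact)).1 h1.symm
  have h3 : Set.EqOn (fun y => pev (∑ i, p i * p i) (φ y)) 0 (interior D) :=
    Measure.eqOn_open_of_ae_eq (ae_restrict_of_ae_restrict_of_subset _root_.interior_subset h2)
      isOpen_interior hcont.continuousOn continuousOn_const
  refine rigidMotion_eq_zero hn1 hn isOpen_interior hD.isConnected_interior.nonempty hp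
    fun y hy => ?_
  have h4 : pev (∑ i, p i * p i) (φ y) = 0 := h3 hy
  rw [pev_sum, Finset.sum_eq_zero_iff_of_nonneg fun i _ => by
    rw [pev_mul]
    exact mul_self_nonneg _] at h4
  ext i
  have h5 := h4 i (Finset.mem_univ i)
  rw [pev_mul, mul_self_eq_zero] at h5
  exact h5

/-! ## Connectivity of the mesh -/

/-- An interior point of `T` lying in `T'` is a limit of interior points of `T'`, and the two
interiors would meet. -/
theorem mem_frontier_of_mem_of_mem {T T' : M.elements} (hne : T ≠ T') {z : Vec (m + 1)}
    (hz : z ∈ (T : Set (Vec (m + 1)))) (hz' : z ∈ (T' : Set (Vec (m + 1)))) :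
    z ∈ frontier (T : Set (Vec (m + 1))) := by
  refine ⟨subset_closure hz, fun hi => ?_⟩
  rw [← (M.isPolytope T' T'.2).closure_interior] at hz'
  obtain ⟨y, hy, hy'⟩ := mem_closure_iff.1 hz' _ isOpen_interior hi
  exact Set.disjoint_left.1 (M.disjoint_interior T T.2 T' T'.2 fun h => hne (Subtype.ext h)) hy hy'

theorem exists_face_of_mem_frontier {T : M.elements} {z : Vec (m + 1)}
    (hz : z ∈ frontier (T : Set (Vec (m + 1)))) :
    ∃ e ∈ M.facesOf T, z ∈ (e : Set (Vec (m + 1))) := by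
  rw [M.frontier_eq_iUnion T] at hz
  simpa only [Set.mem_iUnion, exists_prop] using hz

/-- A nonempty class of elements that is closed under passing to a neighbour across a common face
consists of all elements. -/
theorem forall_elements_of_neighbours (hopen : IsOpen Ω) (hconn : IsConnected Ω)
    {S : M.elements → Prop} (hS : ∀ T T' : M.elements, ∀ e, e ∈ M.facesOf T → e ∈ M.facesOf T' →
      S T → S T') {T₀ : M.elements} (h₀ : S T₀) (T₁ : M.elements) : S T₁ := by
  by_contra h₁
  let U (Q : M.elements → Prop) : Set (Vec (m + 1)) := ⋃ T : {T : M.elements // Q T}, (T.1 : Set _)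
  have hUc : ∀ Q, IsClosed (U Q) := fun Q =>
    isClosed_iUnion_of_finite fun T => (M.isPolytope T.1 T.1.2).isCompact.isClosed
  have hcov : Ω ⊆ U S ∪ U fun T => ¬ S T := by
    intro x hx
    have hx' := subset_closure hx
    rw [← M.iUnion_elements] at hx'
    obtain ⟨T, hT, hxT⟩ := Set.mem_iUnion₂.1 hx'
    by_cases hST : S ⟨T, hT⟩
    · exact Or.inl (Set.mem_iUnion.2 ⟨⟨⟨T, hT⟩, hST⟩, hxT⟩)
    · exact Or.inr (Set.mem_iUnion.2 ⟨⟨⟨T, hT⟩, hST⟩, hxT⟩)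
  have hmeet : ∀ Q (T : M.elements), Q T → (Ω ∩ U Q).Nonempty := fun Q T hQ => by
    obtain ⟨x, hx⟩ := (M.isPolytope T T.2).isConnected_interior.nonempty
    exact ⟨x, M.interior_subset T T.2 hx,
      Set.mem_iUnion.2 ⟨⟨T, hQ⟩, _root_.interior_subset hx⟩⟩
  -- Connectedness gives a point common to both classes, but it may be a vertex or lie on an edge of
  -- a face. It only serves to find a ball in `Ω` that meets the interiors of elements of both
  -- classes.
  obtain ⟨z, hzΩ, hz, hz'⟩ := isPreconnected_closed_iff.1 hconn.isPreconnected _ _ (hUc _) (hUc _)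
    hcov (hmeet S T₀ h₀) (hmeet (fun T => ¬ S T) T₁ h₁)
  obtain ⟨⟨T, hT⟩, hzT⟩ := Set.mem_iUnion.1 hz
  obtain ⟨⟨T', hT'⟩, hzT'⟩ := Set.mem_iUnion.1 hz'
  obtain ⟨r, hr, hball⟩ := Metric.isOpen_iff.1 hopen z hzΩ
  simp only at hzT hzT'
  rw [← (M.isPolytope T T.2).closure_interior] at hzT
  rw [← (M.isPolytope T' T'.2).closure_interior] at hzT'
  obtain ⟨x₀, hx₀, hx₀'⟩ := mem_closure_iff.1 hzT _ Metric.isOpen_ball (Metric.mem_ball_self hr)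
  obtain ⟨y₀, hy₀, hy₀'⟩ := mem_closure_iff.1 hzT' _ Metric.isOpen_ball (Metric.mem_ball_self hr)
  let v := y₀ - x₀
  have hreg : ∀ᵐ x : Vec (m + 1), ∀ T : M.elements, ∀ e ∈ M.facesOf T, ∀ τ : ℝ,
      x + τ • v ∈ (e : Set (Vec (m + 1))) →
      x + τ • v ∈ intrinsicInterior ℝ (e : Set (Vec (m + 1))) ∧
        inner ℝ (M.normal T e) v ≠ 0 :=
    eventually_all.2 fun T => M.ae_line_regular T v
  -- With `v` fixed, the base points whose segment still joins the two interiors inside the ball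
  -- form an open set, so one of them is in general position.
  have hopen' : IsOpen ((Metric.ball z r ∩ interior (T : Set (Vec (m + 1)))) ∩
      (fun x => x + v) ⁻¹' (Metric.ball z r ∩ interior (T' : Set (Vec (m + 1))))) :=
    (Metric.isOpen_ball.inter isOpen_interior).inter
      ((Metric.isOpen_ball.inter isOpen_interior).preimage (by fun_prop))
  obtain ⟨x, ⟨hx, hxv⟩, hxreg⟩ := (Measure.dense_of_ae hreg).inter_open_nonempty _ hopen'
    ⟨x₀, ⟨hx₀, hx₀'⟩, by simpa [v] using ⟨hy₀, hy₀'⟩⟩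
  have hline : Continuous fun τ : ℝ => x + τ • v := by fun_prop
  have hseg : ∀ τ ∈ Set.Icc (0 : ℝ) 1, x + τ • v ∈ Ω := by
    intro τ hτ
    refine hball ((convex_ball z r).add_smul_mem hx.1 hxv.1 hτ)
  -- Connectedness is used again, now on the segment: the point where the classes meet lies on a
  -- regular line.
  obtain ⟨τ, hτ, hτS, hτS'⟩ := isPreconnected_closed_iff.1
    (isPreconnected_Icc : IsPreconnected (Set.Icc (0 : ℝ) 1)) _ _
    ((hUc S).preimage hline) ((hUc fun T => ¬ S T).preimage hline)
    (fun τ hτ => hcov (hseg τ hτ))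
    ⟨0, by simp, Set.mem_iUnion.2 ⟨⟨T, hT⟩, by simpa using _root_.interior_subset hx.2⟩⟩
    ⟨1, by simp, Set.mem_iUnion.2 ⟨⟨T', hT'⟩, by simpa using _root_.interior_subset hxv.2⟩⟩
  obtain ⟨⟨T₂, hT₂⟩, h₂⟩ := Set.mem_iUnion.1 hτS
  obtain ⟨⟨T₃, hT₃⟩, h₃⟩ := Set.mem_iUnion.1 hτS'
  have hne : T₂ ≠ T₃ := fun h => hT₃ (h ▸ hT₂)
  obtain ⟨e₂, he₂, hz₂⟩ := M.exists_face_of_mem_frontier (M.mem_frontier_of_mem_of_mem hne h₂ h₃)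
  obtain ⟨e₃, he₃, hz₃⟩ :=
    M.exists_face_of_mem_frontier (M.mem_frontier_of_mem_of_mem hne.symm h₃ h₂)
  -- The point is in the relative interior of both faces, and distinct faces have disjoint relative
  -- interiors. So the two elements share a face.
  have heq : e₂ = e₃ := by
    by_contra hcon
    exact Set.disjoint_left.1 (M.disjoint_faces e₂ e₂.2 e₃ e₃.2 fun h => hcon (Subtype.ext h))
      (hxreg T₂ e₂ he₂ τ hz₂).1 (hxreg T₃ e₃ he₃ τ hz₃).1
  exact hT₃ (hS T₂ T₃ e₂ he₂ (heq ▸ he₃) hT₂)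

/-- Some face lies on the boundary of the domain. -/
theorem exists_boundary_face (hopen : IsOpen Ω) (hne : Ω.Nonempty) :
    ∃ (T : M.elements), ∃ e ∈ M.facesOf T, (e : Set (Vec (m + 1))) ⊆ frontier Ω := by
  let v : Vec (m + 1) := EuclideanSpace.single 0 1
  have hv : v ≠ 0 := by simp [v]
  have hreg : ∀ᵐ x : Vec (m + 1), ∀ T : M.elements, ∀ e ∈ M.facesOf T, ∀ τ : ℝ,
      x + τ • v ∈ (e : Set (Vec (m + 1))) →
      x + τ • v ∈ intrinsicInterior ℝ (e : Set (Vec (m + 1))) ∧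
        inner ℝ (M.normal T e) v ≠ 0 :=
    eventually_all.2 fun T => M.ae_line_regular T v
  obtain ⟨x, hx, hxreg⟩ := (Measure.dense_of_ae hreg).inter_open_nonempty _ hopen hne
  have hcomp : IsCompact (closure Ω) := by
    rw [← M.iUnion_elements]
    exact M.elements.isCompact_biUnion fun T hT => (M.isPolytope T hT).isCompact
  have hce : Topology.IsClosedEmbedding fun s : ℝ => x + s • v :=
    (Homeomorph.addLeft x).isClosedEmbedding.comp (isClosedEmbedding_smul_left hv)
  -- Consider the last point of `closure Ω` on a regular line starting in `Ω`. It cannot lie in the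
  -- open set `Ω`, yet it is in the relative interior of a face, which therefore is not an interior
  -- face.
  obtain ⟨τ, hτ, hmax⟩ := (hce.isCompact_preimage hcomp).exists_isGreatest
    ⟨0, by simpa using subset_closure hx⟩
  have hzΩ : x + τ • v ∉ Ω := by
    intro hz
    have hev := (hce.continuous.continuousAt.eventually_mem (hopen.mem_nhds hz)).filter_mono
      (nhdsWithin_le_nhds (s := Set.Ioi τ))
    obtain ⟨s, hs, hs'⟩ := (hev.and self_mem_nhdsWithin).exists
    exact absurd (hmax (subset_closure hs)) (not_le.2 hs')
  have hτ' : x + τ • v ∈ closure Ω := hτ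
  rw [← M.iUnion_elements] at hτ'
  obtain ⟨T, hT, hzT⟩ := Set.mem_iUnion₂.1 hτ'
  obtain ⟨e, he, hze⟩ := M.exists_face_of_mem_frontier (T := ⟨T, hT⟩)
    ⟨subset_closure hzT, fun hi => hzΩ (M.interior_subset T hT hi)⟩
  refine ⟨⟨T, hT⟩, e, he, (M.boundary_or_interior e e.2).resolve_right fun h => hzΩ (h ?_)⟩
  exact (hxreg _ e he τ hze).1

/-- The bilinear form is definite on `V_h^0`. -/
theorem eq_zero_of_mem_V0 (hopen : IsOpen Ω) (hconn : IsConnected Ω) {k : ℕ} {mu lam : ℝ}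
    (hmu : 0 < mu) (hlam : 0 ≤ lam) {v : M.Pairs} (hv : v ∈ M.V0 k)
    (h : M.aS k mu lam v v = 0) : v = 0 := by
  have hRM := fun T => (M.mem_RM_of_aS_self hmu hlam hv.1 h T).1
  have hb := fun T => (M.mem_RM_of_aS_self hmu hlam hv.1 h T).2
  obtain ⟨T₀, e₀, he₀, hbd⟩ := M.exists_boundary_face hopen hconn.nonempty
  have h₀ : v.1 T₀ = 0 := by
    refine M.eq_zero_of_faceVec_eq_zero he₀ (hRM T₀) ?_
    rw [← hb T₀ e₀ he₀, hv.2 e₀ hbd]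
  have hT : ∀ T, v.1 T = 0 := by
    refine M.forall_elements_of_neighbours hopen hconn (S := fun T => v.1 T = 0)
      (fun T T' e he he' h0 => ?_) h₀
    refine M.eq_zero_of_faceVec_eq_zero he' (hRM T') ?_
    rw [← hb T' e he', hb T e he, h0, map_zero]
  refine Prod.ext (funext hT) (funext fun e => ?_)
  obtain ⟨T, hTm, he⟩ := M.face_of_element e e.2
  rw [hb ⟨T, hTm⟩ e (mem_facesOf.2 he), hT, map_zero]
  rfl

end Mesh

namespace Mesh

section Linearity

variable {d : ℕ} {Ω : Set (Vec d)} (M : Mesh Ω)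

/-! ## Linearity of the discrete operators -/

theorem matInner_add_left (T : M.elements) (A B C : Matrix (Fin d) (Fin d) (Poly d)) :
    M.matInner T (A + B) C = M.matInner T A C + M.matInner T B C := by
  simp [matInner, Matrix.add_apply, inner_add_left, Finset.sum_add_distrib]

theorem matInner_smul_left (T : M.elements) (c : ℝ) (A C : Matrix (Fin d) (Fin d) (Poly d)) :
    M.matInner T (c • A) C = c * M.matInner T A C := by
  simp [matInner, Matrix.smul_apply, real_inner_smul_left, Finset.mul_sum]

theorem matInner_comm (T : M.elements) (A B : Matrix (Fin d) (Fin d) (Poly d)) :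
    M.matInner T A B = M.matInner T B A := by
  simp only [matInner, real_inner_comm]

/-- The sum of the two weak gradients satisfies the defining relation for the sum. -/
theorem gradW_add (k : ℕ) (v w : M.Pairs) (T : M.elements) :
    M.gradW k (v + w) T = M.gradW k v T + M.gradW k w T := by
  obtain ⟨hv, hv'⟩ := M.isWeakGrad_gradW k v T
  obtain ⟨hw, hw'⟩ := M.isWeakGrad_gradW k w T
  refine M.gradW_eq_of_isWeakGrad ⟨fun i j => Submodule.add_mem _ (hv i j) (hw i j), fun Φ hΦ => ?_⟩
  rw [M.matInner_add_left, hv' Φ hΦ, hw' Φ hΦ]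
  simp only [Prod.fst_add, Prod.snd_add, Pi.add_apply, map_add, inner_add_left,
    Finset.sum_add_distrib]
  ring

theorem gradW_smul (k : ℕ) (c : ℝ) (v : M.Pairs) (T : M.elements) :
    M.gradW k (c • v) T = c • M.gradW k v T := by
  obtain ⟨hv, hv'⟩ := M.isWeakGrad_gradW k v T
  refine M.gradW_eq_of_isWeakGrad ⟨fun i j => Submodule.smul_mem _ c (hv i j), fun Φ hΦ => ?_⟩
  rw [M.matInner_smul_left, hv' Φ hΦ]
  simp only [Prod.smul_fst, Prod.smul_snd, Pi.smul_apply, map_smul, real_inner_smul_left,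
    ← Finset.mul_sum]
  ring

theorem divW_add (k : ℕ) (v w : M.Pairs) (T : M.elements) :
    M.divW k (v + w) T = M.divW k v T + M.divW k w T := by
  obtain ⟨hv, hv'⟩ := M.isWeakDiv_divW k v T
  obtain ⟨hw, hw'⟩ := M.isWeakDiv_divW k w T
  refine M.divW_eq_of_isWeakDiv ⟨Submodule.add_mem _ hv hw, fun φ hφ => ?_⟩
  rw [map_add, inner_add_left, hv' φ hφ, hw' φ hφ]
  simp only [Prod.fst_add, Prod.snd_add, Pi.add_apply, map_add, inner_add_left,
    Finset.sum_add_distrib]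
  ring

theorem divW_smul (k : ℕ) (c : ℝ) (v : M.Pairs) (T : M.elements) :
    M.divW k (c • v) T = c • M.divW k v T := by
  obtain ⟨hv, hv'⟩ := M.isWeakDiv_divW k v T
  refine M.divW_eq_of_isWeakDiv ⟨Submodule.smul_mem _ c hv, fun φ hφ => ?_⟩
  rw [map_smul, real_inner_smul_left, hv' φ hφ]
  simp only [Prod.smul_fst, Prod.smul_snd, Pi.smul_apply, map_smul, real_inner_smul_left,
    ← Finset.mul_sum]
  ring

theorem strainW_add (k : ℕ) (v w : M.Pairs) (T : M.elements) :
    M.strainW k (v + w) T = M.strainW k v T + M.strainW k w T := by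
  rw [strainW, strainW, strainW, M.gradW_add, Matrix.transpose_add, ← smul_add]
  congr 1
  abel

theorem strainW_smul (k : ℕ) (c : ℝ) (v : M.Pairs) (T : M.elements) :
    M.strainW k (c • v) T = c • M.strainW k v T := by
  rw [strainW, strainW, M.gradW_smul, Matrix.transpose_smul, ← smul_add, smul_comm]

theorem jump_add (k : ℕ) (v w : M.Pairs) (T : M.elements) (e : M.faces) :
    M.jump k (v + w) T e = M.jump k v T e + M.jump k w T e := by
  simp only [jump, Qb, Prod.fst_add, Prod.snd_add, Pi.add_apply, map_add]
  abel

theorem jump_smul (k : ℕ) (c : ℝ) (v : M.Pairs) (T : M.elements) (e : M.faces) :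
    M.jump k (c • v) T e = c • M.jump k v T e := by
  simp only [jump, Qb, Prod.smul_fst, Prod.smul_snd, Pi.smul_apply, map_smul, smul_sub]

theorem aS_comm (k : ℕ) (mu lam : ℝ) (v w : M.Pairs) : M.aS k mu lam v w = M.aS k mu lam w v := by
  simp only [aS, stab, M.matInner_comm _ (M.strainW k v _), real_inner_comm]

theorem aS_add_left (k : ℕ) (mu lam : ℝ) (v w z : M.Pairs) :
    M.aS k mu lam (v + w) z = M.aS k mu lam v z + M.aS k mu lam w z := by
  simp only [aS, stab, M.strainW_add, M.divW_add, M.jump_add, M.matInner_add_left, map_add,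
    inner_add_left, mul_add, Finset.sum_add_distrib]
  ring

theorem aS_smul_left (k : ℕ) (mu lam : ℝ) (c : ℝ) (v z : M.Pairs) :
    M.aS k mu lam (c • v) z = c * M.aS k mu lam v z := by
  simp only [aS, stab, M.strainW_smul, M.divW_smul, M.jump_smul, M.matInner_smul_left, map_smul,
    real_inner_smul_left, mul_add, Finset.mul_sum]
  refine congrArg₂ _ (congrArg₂ _ ?_ ?_) ?_
  · exact Finset.sum_congr rfl fun _ _ => by ring
  · exact Finset.sum_congr rfl fun _ _ => by ring
  · exact Finset.sum_congr rfl fun _ _ => Finset.sum_congr rfl fun _ _ => by ring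

/-- The bilinear form `a_s` as a bilinear map. -/
def aSBilin (k : ℕ) (mu lam : ℝ) : M.Pairs →ₗ[ℝ] M.Pairs →ₗ[ℝ] ℝ :=
  LinearMap.mk₂ ℝ (M.aS k mu lam) (M.aS_add_left k mu lam) (M.aS_smul_left k mu lam)
    (fun v w z => by
      rw [M.aS_comm, M.aS_add_left, M.aS_comm k mu lam w, M.aS_comm k mu lam z])
    (fun c v z => by
      rw [M.aS_comm, M.aS_smul_left, M.aS_comm k mu lam z, smul_eq_mul])

instance finiteDimensional_V0 (k : ℕ) : FiniteDimensional ℝ (M.V0 k) := by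
  have := finiteDimensional_PVec d k
  let f : M.V0 k →ₗ[ℝ] (M.elements → PVec d k) × (∀ e : M.faces, M.faceSpace k e) :=
    { toFun := fun v => (fun T => ⟨v.1.1 T, v.2.1.1 T⟩, fun e => ⟨v.1.2 e, v.2.1.2 e⟩)
      map_add' := fun _ _ => rfl
      map_smul' := fun _ _ => rfl }
  refine FiniteDimensional.of_injective f fun v w h => ?_
  have h' := Prod.ext_iff.1 h
  refine Subtype.ext (Prod.ext (funext fun T => ?_) (funext fun e => ?_))
  · exact congrArg Subtype.val (congrFun h'.1 T)
  · exact congrArg Subtype.val (congrFun h'.2 e)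

end Linearity

variable {m : ℕ} {Ω : Set (Vec (m + 1))} (M : Mesh Ω)

/-! ## The load functional -/

/-- `T` may leave the open set `Ω`, but only through its frontier, which is null. Thus data given
almost everywhere on `Ω` can be integrated over `T`. -/
theorem restrict_element_le (T : M.elements) :
    (volume : Measure (Vec (m + 1))).restrict (T : Set (Vec (m + 1))) ≤ volume.restrict Ω := by
  have h : (volume : Measure (Vec (m + 1))).restrict (T : Set (Vec (m + 1))) =
      volume.restrict (interior (T : Set (Vec (m + 1)))) := by
    refine Measure.restrict_congr_set ?_
    filter_upwards [M.ae_notMem_frontier T] with x hx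
    refine propext ⟨fun hxT => ?_, fun hxT => _root_.interior_subset hxT⟩
    by_contra hi
    exact hx ⟨subset_closure hxT, hi⟩
  rw [h]
  exact Measure.restrict_mono (M.interior_subset T T.2) le_rfl

theorem integrableOn_inner_vev (T : M.elements) (f : Lp (Vec (m + 1)) 2 (volume.restrict Ω))
    (p : Fin (m + 1) → Poly (m + 1)) :
    IntegrableOn (fun x => inner ℝ (f x) (vev p x)) (T : Set (Vec (m + 1))) := by
  have hK := (M.isPolytope T T.2).isCompact
  have h1 : MemLp f 2 (volume.restrict (T : Set (Vec (m + 1)))) :=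
    (Lp.memLp f).mono_measure (M.restrict_element_le T)
  have h2 := memLp_of_continuous volume hK hK.measure_lt_top.ne (continuous_vev p)
  refine (L2.integrable_inner (𝕜 := ℝ) h1.toLp h2.toLp).congr ?_
  filter_upwards [h1.coeFn_toLp, h2.coeFn_toLp] with x hx hx'
  rw [hx, hx']

/-- The load as a linear functional. -/
def loadLin (f : Lp (Vec (m + 1)) 2 (volume.restrict Ω)) : M.Pairs →ₗ[ℝ] ℝ where
  toFun := M.load f
  map_add' v w := by
    rw [load, load, load, ← Finset.sum_add_distrib]
    refine Finset.sum_congr rfl fun T _ => ?_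
    rw [← integral_add (M.integrableOn_inner_vev T f _) (M.integrableOn_inner_vev T f _)]
    refine integral_congr_ae (ae_of_all _ fun x => ?_)
    have : vev ((v + w).1 T) x = vev (v.1 T) x + vev (w.1 T) x := by
      ext i
      simp [vev, pev]
    simp only [this, inner_add_right]
  map_smul' c v := by
    rw [load, load, RingHom.id_apply, smul_eq_mul, Finset.mul_sum]
    refine Finset.sum_congr rfl fun T _ => ?_
    rw [← integral_const_mul]
    refine integral_congr_ae (ae_of_all _ fun x => ?_)
    have : vev ((c • v).1 T) x = c • vev (v.1 T) x := by
      ext i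
      simp [vev, pev]
    simp only [this, inner_smul_right]

/-- Unique solvability of the primal weak Galerkin scheme. -/
theorem existsUnique_isSolution (hopen : IsOpen Ω) (hconn : IsConnected Ω) {k : ℕ} {mu lam : ℝ}
    (hmu : 0 < mu) (hlam : 0 ≤ lam) (f : Lp (Vec (m + 1)) 2 (volume.restrict Ω))
    (uhat : Lp (Vec (m + 1)) 2 (surf (frontier Ω))) :
    ∃! u : M.Pairs, M.IsSolution k mu lam f uhat u := by
  classical
  -- A lift of the boundary data: the prescribed projection on boundary faces and zero elsewhere.
  let g : M.Pairs := (0, fun e => if he : (e : Set (Vec (m + 1))) ⊆ frontier Ω then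
    M.Qb k e (M.restrictToFace uhat e he) else 0)
  have hg : g ∈ M.V k := by
    refine ⟨fun T => Submodule.zero_mem _, fun e => ?_⟩
    by_cases he : (e : Set (Vec (m + 1))) ⊆ frontier Ω
    · simp only [g, dif_pos he]
      exact Submodule.starProjection_apply_mem _ _
    · simp only [g, dif_neg he]
      exact Submodule.zero_mem _
  -- The correction `q ∈ V_h^0` solves the problem with the load reduced by `a_s(g, ·)`. Any
  -- solution minus `g` solves the same problem, which gives uniqueness.
  obtain ⟨q, ⟨hq, hq'⟩, huniq⟩ := existsUnique_riesz (M.V0 k) (M.aSBilin k mu lam)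
    (fun p hp h => M.eq_zero_of_mem_V0 hopen hconn hmu hlam hp h)
    (M.loadLin f - M.aSBilin k mu lam g)
  refine ⟨g + q, ⟨Submodule.add_mem _ hg hq.1, fun e he => ?_, fun v hv => ?_⟩, fun u hu => ?_⟩
  · change g.2 e + q.2 e = _
    rw [hq.2 e he, add_zero]
    simp only [g, dif_pos he]
  · rw [M.aS_add_left]
    have h : M.aS k mu lam q v = M.load f v - M.aS k mu lam g v := hq' v hv
    rw [h, add_sub_cancel]
  · rw [← huniq (u - g) ⟨⟨Submodule.sub_mem _ hu.1 hg, fun e he => ?_⟩, fun v hv => ?_⟩]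
    · abel
    · change u.2 e - g.2 e = 0
      rw [hu.2.1 e he]
      simp only [g, dif_pos he, sub_self]
    · have h : M.aSBilin k mu lam u v = M.loadLin f v := hu.2.2 v hv
      rw [map_sub, LinearMap.sub_apply, LinearMap.sub_apply, h]

end Mesh

end WG

end

theorem mainTheorem3 (d : ℕ) (hd : d = 2 ∨ d = 3) (Ω : Set (WG.Vec d)) (hopen : IsOpen Ω)
    (hbdd : Bornology.IsBounded Ω) (hconn : IsConnected Ω) (M : WG.Mesh Ω)
    (k : ℕ) (hk : 1 ≤ k) (mu lam : ℝ) (hmu : 0 < mu) (hlam : 0 ≤ lam)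
    (f : Lp (WG.Vec d) 2 (volume.restrict Ω))
    (uhat : Lp (WG.Vec d) 2 (WG.surf (frontier Ω))) :
    ∃! u : M.Pairs, M.IsSolution k mu lam f uhat u := by
  obtain ⟨m, rfl⟩ : ∃ m, d = m + 1 := ⟨d - 1, by omega⟩
  exact M.existsUnique_isSolution hopen hconn hmu hlam f uhat
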